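/- Let $\mathbb K=\mathbb R$ or $\mathbb C$. For a Banach space $X$ over $\mathbb K$ let $\mathcal K(X)$ be the space of compact operators $X\to X$ with the operator norm, let $\mathcal A(X)\subset\mathcal K(X)$ be the operator-norm closure of the bounded finite rank operators, and let $\mathfrak A_X=\mathcal K(X)/\mathcal A(X)$ carry the quotient norm. For normed spaces $E,F$ let $d_{BM}(E,F)=\inf\{\|T\|\,\|T^{-1}\| : T\colon E\to F \text{ a linear isomorphism}\}$ be the Banach–Mazur distance ($\infty$ if there is no such $T$). Let $(E_n)_{n\in\mathbb N}$ be a sequence of finite-dimensional normed spaces over $\mathbb K$ that is dense in the Banach–Mazur distance in the class of all finite-dimensional normed spaces, that is, for every non-zero finite-dimensional normed space $F$ over $\mathbb K$ and every $c>1$ there is $n$ with $d_{BM}(E_n,F)<c$. Let $(G_m)_{m\in\mathbb N}$ be a listing of the spaces $E_n$ in which each $E_n$ is repeated infinitely often, that is, $G_m=E_{\sigma(m)}$ where $\sigma\colon\mathbb N\to\mathbb N$ takes every value infinitely often. Let $C_1=\big(\bigoplus_{m\in\mathbb N}G_m\big)_{\ell^1}$ be Johnson's space and $C_1^*$ its dual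 space. Then $\mathfrak A_{C_1^*}$ contains a closed linear subspace that is linearly isomorphic (linearly homeomorphic) to the sequence space $c_0$, whereas $\mathfrak A_{C_1}=\{0\}$. -/

import Mathlib

open scoped ENNReal ZeroAtInfty

noncomputable section

universe u v w

/-- The linear subspace of bounded finite rank operators `X → Y`. -/
def finiteRankOperators (𝕜 : Type u) [RCLike 𝕜] (X : Type v) (Y : Type w)
    [NormedAddCommGroup X] [NormedSpace 𝕜 X] [NormedAddCommGroup Y] [NormedSpace 𝕜 Y] :
    Submodule 𝕜 (X →L[𝕜] Y) :=
  (LinearMap.finiteRange 𝕜 X Y).comap (ContinuousLinearMap.coeLM 𝕜)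

/-- The approximable operators `𝒜(X, Y)`: the operator norm closure of the bounded finite rank
operators. -/
def approximableOperators (𝕜 : Type u) [RCLike 𝕜] (X : Type v) (Y : Type w)
    [NormedAddCommGroup X] [NormedSpace 𝕜 X] [NormedAddCommGroup Y] [NormedSpace 𝕜 Y] :
    Submodule 𝕜 (X →L[𝕜] Y) :=
  (finiteRankOperators 𝕜 X Y).topologicalClosure

/-- The compact operators `𝒦(X)`, with the operator norm. -/
abbrev CompactOperators (𝕜 : Type u) [RCLike 𝕜] (X : Type v)
    [NormedAddCommGroup X] [NormedSpace 𝕜 X] : Submodule 𝕜 (X →L[𝕜] X) :=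
  compactOperator (RingHom.id 𝕜) X X

/-- `𝒜(X)` as a subspace of `𝒦(X)`. -/
abbrev approximableInCompact (𝕜 : Type u) [RCLike 𝕜] (X : Type v)
    [NormedAddCommGroup X] [NormedSpace 𝕜 X] : Submodule 𝕜 (CompactOperators 𝕜 X) :=
  (approximableOperators 𝕜 X X).submoduleOf (CompactOperators 𝕜 X)

instance isClosed_approximableInCompact (𝕜 : Type u) [RCLike 𝕜] (X : Type v)
    [NormedAddCommGroup X] [NormedSpace 𝕜 X] :
    IsClosed (approximableInCompact 𝕜 X : Set (CompactOperators 𝕜 X)) :=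
  (Submodule.isClosed_topologicalClosure (finiteRankOperators 𝕜 X X)).preimage
    continuous_subtype_val

/-- The quotient `𝒦(X) / 𝒜(X)`, with the quotient norm `‖T + 𝒜(X)‖ = dist(T, 𝒜(X))`. -/
abbrev CompactByApproximable (𝕜 : Type u) [RCLike 𝕜] (X : Type v)
    [NormedAddCommGroup X] [NormedSpace 𝕜 X] : Type v :=
  CompactOperators 𝕜 X ⧸ approximableInCompact 𝕜 X

/-- The Banach-Mazur distance, the infimum of `‖T‖ ‖T⁻¹‖` over the linear isomorphisms
`T : E → F`; it is `∞` if there are none. -/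
def banachMazurDist (𝕜 : Type u) [RCLike 𝕜] (E : Type v) (F : Type w)
    [NormedAddCommGroup E] [NormedSpace 𝕜 E] [NormedAddCommGroup F] [NormedSpace 𝕜 F] : ℝ≥0∞ :=
  ⨅ T : E ≃L[𝕜] F, ENNReal.ofReal (‖(T : E →L[𝕜] F)‖ * ‖(T.symm : F →L[𝕜] E)‖)

/-- The sequence `(E n)` is dense, in the Banach-Mazur distance, in the class of all
finite-dimensional normed spaces. The zero space is allowed among the `E n` but not required.
Every finite-dimensional normed space is isometric to some norm on a power `𝕜ᵏ`, so letting `F`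
range over the universe of `𝕜` loses nothing. -/
def BanachMazurDense (𝕜 : Type u) [RCLike 𝕜] (E : ℕ → Type v)
    [∀ n, NormedAddCommGroup (E n)] [∀ n, NormedSpace 𝕜 (E n)] : Prop :=
  ∀ (F : Type u) [NormedAddCommGroup F] [NormedSpace 𝕜 F] [FiniteDimensional 𝕜 F] [Nontrivial F]
    (c : ℝ≥0∞), 1 < c → ∃ n, banachMazurDist 𝕜 (E n) F < c

/-- `X` contains a linear isomorphic copy of the sequence space `c₀`: some closed linear subspace
of `X` is linearly homeomorphic to `c₀`. -/
def ContainsCopyOfC0 (𝕜 : Type u) [RCLike 𝕜] (X : Type v)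
    [NormedAddCommGroup X] [NormedSpace 𝕜 X] : Prop :=
  ∃ W : Submodule 𝕜 X, IsClosed (W : Set X) ∧ Nonempty (C₀(ℕ, 𝕜) ≃L[𝕜] W)

/-- Johnson's space `C₁`: the `ℓ¹`-direct sum of the listing `m ↦ E (σ m)`. -/
abbrev JohnsonC1 (E : ℕ → Type v) [∀ n, NormedAddCommGroup (E n)] (σ : ℕ → ℕ) : Type v :=
  lp (fun m => E (σ m)) 1

end

/-!
The partial sum projections of an `ℓ¹`-sum of finite-dimensional spaces have finite rank and norm
at most one, and converge pointwise to the identity; hence compact operators into it are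
approximable.

Let the normed space `Y` be an increasing union of finite-dimensional subspaces `F n`. By density,
disjoint sets of summands of `C₁` each contain 2-isomorphic copies of all the `F n`, and ultrafilter
limits turn such a set of copies into a complemented copy of `Y*` in `C₁*`. In this way a bounded
sequence `a` gives an operator `B a : Y* → C₁*` which acts as `a k` times the embedding on the
`k`-th copy. If `U : X* → Y*` is compact but not approximable and `P` is a projection of `C₁*` onto
a copy of `X*`, then compressing `B a ∘ U ∘ P` to the `k`-th copy gives `a k • U`. So the distance
of `B a ∘ U ∘ P` to the approximable operators is equivalent to `‖a‖`, and `a ∈ c₀` embeds.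

Such a `U` comes from a construction in the style of Enflo and Davie. Finitely supported families of
coefficients are normed by the supremum of their values at the rows of unimodular matrices, each row
involving two consecutive levels of coefficients. `U` is the adjoint of the identity map from the
norm in which values at level `l` carry the weight `(1 + s) ^ l` to the unweighted norm; the weights
make this map a limit of finite rank operators into `ℓ^∞`, so `U` is compact. The normalized trace
on level `k` is `1` on `U` and tends to `0` on rank one operators. The traces on levels `k` and
`k + 1` can both be expanded along the rows of level `k`, and by the incoherence of the rows the two
expansions differ by a multiple of `((1 + s) q) ^ k`; with `(1 + s) q < 1` this makes the traces
uniformly bounded. Therefore they tend to `0` on all approximable operators, and `U` is not one.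
-/

noncomputable section

universe u v w

open scoped NNReal ComplexConjugate Matrix BigOperators
open Filter Topology

variable {𝕜 : Type u} [RCLike 𝕜]

/-! ### Finite rank, approximable and compact operators -/

section Operators

variable {X X' Y Y' : Type*}
  [NormedAddCommGroup X] [NormedSpace 𝕜 X] [NormedAddCommGroup X'] [NormedSpace 𝕜 X']
  [NormedAddCommGroup Y] [NormedSpace 𝕜 Y] [NormedAddCommGroup Y'] [NormedSpace 𝕜 Y']

lemma comp_comp_mem_finiteRankOperators (R : Y →L[𝕜] Y') (I : X' →L[𝕜] X) {T : X →L[𝕜] Y}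
    (hT : T ∈ finiteRankOperators 𝕜 X Y) :
    R.comp (T.comp I) ∈ finiteRankOperators 𝕜 X' Y' := by
  have hT' : (T : X →ₗ[𝕜] Y).HasNoetherianRange := hT
  exact (hT'.comp_right (I : X' →ₗ[𝕜] X)).comp_left (R : Y →ₗ[𝕜] Y')

lemma comp_comp_mem_approximableOperators (R : Y →L[𝕜] Y') (I : X' →L[𝕜] X) {T : X →L[𝕜] Y}
    (hT : T ∈ approximableOperators 𝕜 X Y) :
    R.comp (T.comp I) ∈ approximableOperators 𝕜 X' Y' :=
  map_mem_closure (f := fun T : X →L[𝕜] Y => R.comp (T.comp I))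
    (t := (finiteRankOperators 𝕜 X' Y' : Set (X' →L[𝕜] Y')))
    (continuous_const.clm_comp (continuous_id.clm_comp continuous_const)) hT
    fun _ hS => comp_comp_mem_finiteRankOperators R I hS

lemma mem_finiteRankOperators_of_finiteDimensional [FiniteDimensional 𝕜 Y] (T : X →L[𝕜] Y) :
    T ∈ finiteRankOperators 𝕜 X Y := by
  change IsNoetherian 𝕜 _
  infer_instance

lemma smulRight_mem_finiteRankOperators (f : StrongDual 𝕜 X) (y : Y) :
    f.smulRight y ∈ finiteRankOperators 𝕜 X Y :=
  comp_comp_mem_finiteRankOperators (ContinuousLinearMap.toSpanSingleton 𝕜 y)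
    (ContinuousLinearMap.id 𝕜 X) (mem_finiteRankOperators_of_finiteDimensional f)

lemma exists_eq_sum_smulRight_of_mem_finiteRankOperators {T : X →L[𝕜] Y}
    (hT : T ∈ finiteRankOperators 𝕜 X Y) :
    ∃ (n : ℕ) (f : Fin n → StrongDual 𝕜 X) (y : Fin n → Y), T = ∑ i, (f i).smulRight (y i) := by
  let W := LinearMap.range (T : X →ₗ[𝕜] Y)
  have : FiniteDimensional 𝕜 W :=
    Module.Finite.of_fg (LinearMap.mem_finiteRange_iff_hasFiniteRange.1 hT)
  let b := Module.finBasis 𝕜 W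
  let T' : X →L[𝕜] W := T.codRestrict W fun x => LinearMap.mem_range_self _ x
  refine ⟨_, fun i => (LinearMap.toContinuousLinearMap (b.coord i)).comp T', fun i => b i, ?_⟩
  ext x
  have hx := congrArg Subtype.val (b.sum_repr (T' x))
  rw [AddSubmonoidClass.coe_finsetSum] at hx
  simp only [FunLike.coe_sum, Finset.sum_apply, ContinuousLinearMap.smulRight_apply]
  exact hx.symm

/-- The adjoint of a bounded operator, acting between the dual spaces. -/
def dualOperator (A : X →L[𝕜] Y) : StrongDual 𝕜 Y →L[𝕜] StrongDual 𝕜 X :=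
  (ContinuousLinearMap.compL 𝕜 X Y 𝕜).flip A

lemma isCompactOperator_dualOperator_smulRight (f : StrongDual 𝕜 X) (y : Y) :
    IsCompactOperator (dualOperator (f.smulRight y)) := by
  have h_eq : dualOperator (f.smulRight y) =
      (ContinuousLinearMap.toSpanSingleton 𝕜 f).comp (ContinuousLinearMap.apply 𝕜 𝕜 y) := by
    ext φ x
    simp [dualOperator, mul_comm]
  have h_apply : IsCompactOperator (ContinuousLinearMap.apply 𝕜 𝕜 y : StrongDual 𝕜 Y →L[𝕜] 𝕜) :=
    isCompactOperator_of_locallyCompactSpace_dom _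
  rw [h_eq]
  exact h_apply.clm_comp (ContinuousLinearMap.toSpanSingleton 𝕜 f)

lemma isCompactOperator_dualOperator_of_mem_finiteRankOperators {A : X →L[𝕜] Y}
    (hA : A ∈ finiteRankOperators 𝕜 X Y) : IsCompactOperator (dualOperator A) := by
  obtain ⟨n, f, y, rfl⟩ := exists_eq_sum_smulRight_of_mem_finiteRankOperators hA
  have h_eq : dualOperator (∑ i, (f i).smulRight (y i)) =
      ∑ i, dualOperator ((f i).smulRight (y i)) :=
    map_sum (ContinuousLinearMap.compL 𝕜 X Y 𝕜).flip _ _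
  rw [h_eq]
  exact Submodule.sum_mem (compactOperator (RingHom.id 𝕜) (StrongDual 𝕜 Y) (StrongDual 𝕜 X))
    fun i _ => isCompactOperator_dualOperator_smulRight (f i) (y i)

lemma isCompactOperator_dualOperator_of_mem_approximableOperators {A : X →L[𝕜] Y}
    (hA : A ∈ approximableOperators 𝕜 X Y) : IsCompactOperator (dualOperator A) := by
  have h_closed : IsClosed {B : X →L[𝕜] Y | IsCompactOperator (dualOperator B)} :=
    isClosed_setOfPred_isCompactOperator.preimage
      (ContinuousLinearMap.compL 𝕜 X Y 𝕜).flip.continuous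
  exact closure_minimal
    (fun _ hB => isCompactOperator_dualOperator_of_mem_finiteRankOperators hB) h_closed hA

lemma exists_dualOperator_isometry_eq (J : X →ₗᵢ[𝕜] Y) (φ : StrongDual 𝕜 X) :
    ∃ ψ : StrongDual 𝕜 Y, dualOperator J.toContinuousLinearMap ψ = φ ∧ ‖ψ‖ ≤ ‖φ‖ := by
  obtain ⟨ψ, hψ, hψn⟩ := exists_extension_norm_eq (LinearMap.range J.toLinearMap)
    (φ.comp (J.equivRange.symm : LinearMap.range J.toLinearMap →L[𝕜] X))
  refine ⟨ψ, ContinuousLinearMap.ext fun x => ?_, ?_⟩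
  · simpa [dualOperator] using hψ (J.equivRange x)
  · rw [hψn]
    refine ContinuousLinearMap.opNorm_le_bound _ (norm_nonneg φ) fun x => ?_
    refine (φ.le_opNorm _).trans_eq (congrArg (‖φ‖ * ·) ?_)
    exact J.equivRange.symm.norm_map x

lemma isCompactOperator_of_comp_dualOperator_isometry {J : X →ₗᵢ[𝕜] Y}
    {V : StrongDual 𝕜 X →L[𝕜] Y'}
    (hV : IsCompactOperator (V.comp (dualOperator J.toContinuousLinearMap))) :
    IsCompactOperator V := by
  obtain ⟨K, hK, hsub⟩ := (isCompactOperator_iff_image_closedBall_subset_compact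
    (V.comp (dualOperator J.toContinuousLinearMap) : StrongDual 𝕜 Y →ₗ[𝕜] Y') zero_lt_one).1 hV
  refine (isCompactOperator_iff_image_closedBall_subset_compact (V : StrongDual 𝕜 X →ₗ[𝕜] Y')
    zero_lt_one).2 ⟨K, hK, ?_⟩
  rintro _ ⟨φ, hφ, rfl⟩
  obtain ⟨ψ, rfl, hψ⟩ := exists_dualOperator_isometry_eq J φ
  rw [mem_closedBall_zero_iff] at hφ
  exact hsub ⟨ψ, mem_closedBall_zero_iff.2 (hψ.trans hφ), rfl⟩

lemma isCompactOperator_dualOperator_of_isometry_comp_mem_approximableOperators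
    {J : Y →ₗᵢ[𝕜] Y'} {A : X →L[𝕜] Y}
    (hA : J.toContinuousLinearMap.comp A ∈ approximableOperators 𝕜 X Y') :
    IsCompactOperator (dualOperator A) :=
  isCompactOperator_of_comp_dualOperator_isometry
    (isCompactOperator_dualOperator_of_mem_approximableOperators hA :
      IsCompactOperator ((dualOperator A).comp (dualOperator J.toContinuousLinearMap)))

theorem mem_approximableOperators_of_tendsto_apply {Q : ℕ → Y →L[𝕜] Y}
    (hQ : ∀ n, Q n ∈ finiteRankOperators 𝕜 Y Y) {C : ℝ} (hC : ∀ n, ‖Q n‖ ≤ C)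
    (hQ_tendsto : ∀ y, Tendsto (fun n => Q n y) atTop (𝓝 y)) {T : X →L[𝕜] Y}
    (hT : IsCompactOperator T) : T ∈ approximableOperators 𝕜 X Y := by
  refine Metric.mem_closure_iff.2 fun ε hε => ?_
  have hC0 : 0 ≤ C := (norm_nonneg _).trans (hC 0)
  obtain ⟨K, hK, hsub⟩ := hT.image_closedBall_subset_compact (f := (T : X →ₗ[𝕜] Y)) 1
  obtain ⟨δ, hδ, hδε⟩ : ∃ δ > 0, (2 + C) * δ < ε :=
    ⟨ε / (3 + C), by positivity, by rw [mul_div_assoc', div_lt_iff₀ (by positivity)]; nlinarith⟩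
  obtain ⟨t, ht, hKt⟩ := Metric.totallyBounded_iff.1 hK.totallyBounded δ hδ
  obtain ⟨n, hn⟩ := ((Filter.eventually_all_finite ht).2 fun y _ =>
    Metric.tendsto_nhds.1 (hQ_tendsto y) δ hδ).exists
  refine ⟨(Q n).comp T, comp_comp_mem_finiteRankOperators (.id 𝕜 Y) T (hQ n), ?_⟩
  rw [dist_eq_norm]
  refine lt_of_le_of_lt
    (ContinuousLinearMap.opNorm_le_of_unit_norm (by positivity) fun x hx => ?_) hδε
  obtain ⟨y, hy, hxy⟩ := Set.mem_iUnion₂.1 (hKt (hsub ⟨x, by simp [hx], rfl⟩))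
  have hTx : ‖T x - y‖ ≤ δ := (mem_ball_iff_norm.1 hxy).le
  have hQy : ‖Q n y - y‖ ≤ δ := (dist_eq_norm (Q n y) y ▸ hn y hy).le
  calc ‖(T - (Q n).comp T) x‖
      = ‖(T x - y) - (Q n y - y) - Q n (T x - y)‖ := by simp
    _ ≤ ‖T x - y‖ + ‖Q n y - y‖ + ‖Q n (T x - y)‖ :=
        (norm_sub_le _ _).trans (by gcongr; exact norm_sub_le _ _)
    _ ≤ δ + δ + C * δ := by gcongr; exact (Q n).le_of_opNorm_le_of_le (hC n) hTx
    _ = (2 + C) * δ := by ring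

end Operators

section LpOne

variable {G : ℕ → Type v} [∀ i, NormedAddCommGroup (G i)]
  [∀ i, NormedSpace 𝕜 (G i)]

variable (𝕜 G) in
/-- The projection of an `ℓ¹`-sum onto the sum of its first `N` summands. -/
def lpOneTrunc (N : ℕ) : lp G 1 →L[𝕜] lp G 1 :=
  ∑ i ∈ Finset.range N, (lp.singleContinuousLinearMap 𝕜 G 1 i).comp (lp.evalCLM 𝕜 G 1 i)

lemma lpOneTrunc_apply (N : ℕ) (z : lp G 1) :
    lpOneTrunc 𝕜 G N z = ∑ i ∈ Finset.range N, lp.single 1 i (z i) := by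
  rw [lpOneTrunc, FunLike.coe_sum, Finset.sum_apply]
  rfl

lemma norm_lpOneTrunc_le (N : ℕ) : ‖lpOneTrunc 𝕜 G N‖ ≤ 1 := by
  refine ContinuousLinearMap.opNorm_le_bound _ zero_le_one fun z => ?_
  have h_eq := lp.norm_sum_single (p := 1) (by simp) z (Finset.range N)
  have h_le := lp.sum_rpow_le_norm_rpow (p := 1) (by simp) z (Finset.range N)
  simp only [ENNReal.toReal_one, Real.rpow_one] at h_eq h_le
  rwa [one_mul, lpOneTrunc_apply, h_eq]

lemma tendsto_lpOneTrunc_apply (z : lp G 1) :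
    Tendsto (fun N => lpOneTrunc 𝕜 G N z) atTop (𝓝 z) := by
  simp only [lpOneTrunc_apply]
  exact (lp.hasSum_single ENNReal.one_ne_top z).tendsto_sum_nat

lemma lpOneTrunc_mem_finiteRankOperators [∀ i, FiniteDimensional 𝕜 (G i)] (N : ℕ) :
    lpOneTrunc 𝕜 G N ∈ finiteRankOperators 𝕜 (lp G 1) (lp G 1) := by
  refine Submodule.sum_mem _ fun i _ => ?_
  have h_id := mem_finiteRankOperators_of_finiteDimensional (ContinuousLinearMap.id 𝕜 (G i))
  simpa only [ContinuousLinearMap.id_comp] using comp_comp_mem_finiteRankOperators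
    (lp.singleContinuousLinearMap 𝕜 G 1 i) (lp.evalCLM 𝕜 G 1 i) h_id

theorem mem_approximableOperators_lp_one_of_isCompactOperator [∀ i, FiniteDimensional 𝕜 (G i)]
    {X : Type w} [NormedAddCommGroup X] [NormedSpace 𝕜 X] {T : X →L[𝕜] lp G 1}
    (hT : IsCompactOperator T) : T ∈ approximableOperators 𝕜 X (lp G 1) :=
  mem_approximableOperators_of_tendsto_apply lpOneTrunc_mem_finiteRankOperators
    norm_lpOneTrunc_le tendsto_lpOneTrunc_apply hT

end LpOne

/-! ### Copies of `c₀` in `𝒦(Z) / 𝒜(Z)` -/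

section CopyOfC0

lemma containsCopyOfC0_of_bounds {X : Type v} [NormedAddCommGroup X] [NormedSpace 𝕜 X]
    (Q : C₀(ℕ, 𝕜) →ₗ[𝕜] X) {C C' : ℝ} (hC : ∀ a, ‖Q a‖ ≤ C * ‖a‖)
    (hC' : ∀ a, ‖a‖ ≤ C' * ‖Q a‖) : ContainsCopyOfC0 𝕜 X := by
  have hinj : Function.Injective Q := by
    refine (injective_iff_map_eq_zero Q).2 fun a ha => norm_le_zero_iff.1 ?_
    simpa [ha] using hC' a
  let e : C₀(ℕ, 𝕜) ≃L[𝕜] LinearMap.range Q :=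
    (LinearEquiv.ofInjective Q hinj).toContinuousLinearEquivOfBounds C C' hC fun x => by
      obtain ⟨a, rfl⟩ := (LinearEquiv.ofInjective Q hinj).surjective x
      rw [LinearEquiv.symm_apply_apply]
      exact hC' a
  have : CompleteSpace (LinearMap.range Q) :=
    (completeSpace_congr (e := e.toEquiv) e.isUniformEmbedding).1 inferInstance
  exact ⟨LinearMap.range Q, (completeSpace_coe_iff_isComplete.1 this).isClosed, ⟨e⟩⟩

lemma exists_pos_forall_mul_norm_le_of_notMem {X : Type v} [NormedAddCommGroup X]
    [NormedSpace 𝕜 X] {N : Submodule 𝕜 X} (hN : IsClosed (N : Set X)) {u : X}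
    (hu : u ∉ N) : ∃ δ > 0, ∀ (r : 𝕜) (v : X), r • u - v ∈ N → ‖r‖ * δ ≤ ‖v‖ := by
  have := hN
  refine ⟨‖N.mkQ u‖, norm_pos_iff.2 fun h => hu ?_, fun r v h => ?_⟩
  · simpa using h
  · have hv : N.mkQ v = r • N.mkQ u := by
      rw [← map_smul]
      exact ((Submodule.Quotient.eq N).2 h).symm
    rw [← norm_smul, ← hv]
    exact Submodule.Quotient.norm_mk_le N v

lemma le_mul_norm_mkQ {R X : Type*} [Ring R] [SeminormedAddCommGroup X] [Module R X]
    {N : Submodule R X} {b M : ℝ} (hM : 0 ≤ M) {x : X} (h : ∀ v, x - v ∈ N → b ≤ M * ‖v‖) :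
    b ≤ M * ‖N.mkQ x‖ := by
  refine le_of_forall_pos_le_add fun ε hε => ?_
  obtain ⟨v, hv, hlt⟩ := Submodule.Quotient.norm_mk_lt (N.mkQ x) (ε := ε / (M + 1))
    (by positivity)
  calc b ≤ M * ‖v‖ := h v ((Submodule.Quotient.eq N).1 hv.symm)
    _ ≤ M * (‖N.mkQ x‖ + ε / (M + 1)) := by gcongr
    _ = M * ‖N.mkQ x‖ + M / (M + 1) * ε := by ring
    _ ≤ M * ‖N.mkQ x‖ + ε := by
      gcongr
      exact mul_le_of_le_one_left hε.le ((div_le_one (by positivity)).2 (by linarith))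

variable {V W Z : Type*} [NormedAddCommGroup V] [NormedSpace 𝕜 V] [NormedAddCommGroup W]
  [NormedSpace 𝕜 W] [NormedAddCommGroup Z] [NormedSpace 𝕜 Z]

/-- The operators `Z → V → W → Z` built from a compact operator `U : V → W`, a fixed operator
`P : Z → V` and the operators `B a : W → Z` indexed by the sequences `a` in `c₀`. -/
def compactMultiplier {U : V →L[𝕜] W} (hU : IsCompactOperator U) (P : Z →L[𝕜] V)
    (B : BoundedContinuousFunction ℕ 𝕜 →ₗ[𝕜] W →L[𝕜] Z) :
    C₀(ℕ, 𝕜) →ₗ[𝕜] CompactOperators 𝕜 Z where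
  toFun a := ⟨(B a.toBCF).comp (U.comp P), (hU.comp_clm P).clm_comp (B a.toBCF)⟩
  map_add' a a' := Subtype.ext
    (congrArg (·.comp (U.comp P)) (map_add B a.toBCF a'.toBCF))
  map_smul' r a := Subtype.ext
    (congrArg (·.comp (U.comp P)) (map_smul B r a.toBCF))

lemma exists_norm_le_mul_norm_of_compactMultiplier_sub_mem {U : V →L[𝕜] W}
    (hU : IsCompactOperator U) (hU' : U ∉ approximableOperators 𝕜 V W)
    {P : Z →L[𝕜] V} {I : V →L[𝕜] Z} (hPI : ∀ x, P (I x) = x)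
    {B : BoundedContinuousFunction ℕ 𝕜 →ₗ[𝕜] W →L[𝕜] Z} {R : ℕ → Z →L[𝕜] W} {K : ℝ}
    (hR : ∀ l, ‖R l‖ ≤ K) (hRB : ∀ l a ψ, R l (B a ψ) = a l • ψ) :
    ∃ M ≥ 0, ∀ (a : C₀(ℕ, 𝕜)) (S : CompactOperators 𝕜 Z),
      compactMultiplier hU P B a - S ∈ approximableInCompact 𝕜 Z → ‖a‖ ≤ M * ‖S‖ := by
  obtain ⟨δ, hδ, hUδ⟩ := exists_pos_forall_mul_norm_le_of_notMem
    (Submodule.isClosed_topologicalClosure (finiteRankOperators 𝕜 V W)) hU'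
  have hK : 0 ≤ K := (norm_nonneg _).trans (hR 0)
  refine ⟨K * ‖I‖ / δ, by positivity, fun a S hS => ?_⟩
  rw [← ZeroAtInftyContinuousMap.norm_toBCF_eq_norm]
  refine (BoundedContinuousFunction.norm_le (by positivity)).2 fun l => ?_
  have h_compress : (R l).comp (((B a.toBCF).comp (U.comp P) - S.1).comp I) =
      a l • U - (R l).comp (S.1.comp I) := by
    ext x
    simp [hPI, hRB]
  have h_mem := comp_comp_mem_approximableOperators (R l) I hS
  calc ‖a l‖ ≤ ‖(R l).comp (S.1.comp I)‖ / δ :=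
        (le_div_iff₀ hδ).2 (hUδ (a l) _ (h_compress ▸ h_mem))
    _ ≤ K * (‖S.1‖ * ‖I‖) / δ := by
      gcongr
      exact (ContinuousLinearMap.opNorm_comp_le _ _).trans
        (mul_le_mul (hR l) (ContinuousLinearMap.opNorm_comp_le _ _) (norm_nonneg _) hK)
    _ = K * ‖I‖ / δ * ‖S‖ := by rw [Submodule.coe_norm]; ring

theorem containsCopyOfC0_compactByApproximable {U : V →L[𝕜] W} (hU : IsCompactOperator U)
    (hU' : U ∉ approximableOperators 𝕜 V W) {P : Z →L[𝕜] V} {I : V →L[𝕜] Z}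
    (hPI : ∀ x, P (I x) = x) {B : BoundedContinuousFunction ℕ 𝕜 →ₗ[𝕜] W →L[𝕜] Z} {K K' : ℝ}
    (hB : ∀ a, ‖B a‖ ≤ K * ‖a‖) {R : ℕ → Z →L[𝕜] W} (hR : ∀ l, ‖R l‖ ≤ K')
    (hRB : ∀ l a ψ, R l (B a ψ) = a l • ψ) :
    ContainsCopyOfC0 𝕜 (CompactByApproximable 𝕜 Z) := by
  obtain ⟨M, hM, h_lower⟩ :=
    exists_norm_le_mul_norm_of_compactMultiplier_sub_mem hU hU' hPI hR hRB
  have h_upper : ∀ a, ‖compactMultiplier hU P B a‖ ≤ K * ‖U.comp P‖ * ‖a‖ := fun a =>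
    calc ‖(B a.toBCF).comp (U.comp P)‖ ≤ ‖B a.toBCF‖ * ‖U.comp P‖ :=
          ContinuousLinearMap.opNorm_comp_le _ _
      _ ≤ K * ‖a‖ * ‖U.comp P‖ := by
        gcongr
        rw [← ZeroAtInftyContinuousMap.norm_toBCF_eq_norm]
        exact hB a.toBCF
      _ = K * ‖U.comp P‖ * ‖a‖ := by ring
  exact containsCopyOfC0_of_bounds ((approximableInCompact 𝕜 Z).mkQ ∘ₗ compactMultiplier hU P B)
    (fun a => (Submodule.Quotient.norm_mk_le _ (compactMultiplier hU P B a)).trans (h_upper a))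
    fun a => le_mul_norm_mkQ hM (h_lower a)

end CopyOfC0

/-! ### Complemented dual spaces in the dual of an `ℓ¹`-sum -/

section Ultralimit

variable {ι : Type*} (𝒰 : Ultrafilter ι)

lemma exists_tendsto_ultrafilter_of_norm_le {f : ι → 𝕜} {r : ℝ} (h : ∀ᶠ i in 𝒰, ‖f i‖ ≤ r) :
    ∃ a, ‖a‖ ≤ r ∧ Tendsto f 𝒰 (𝓝 a) := by
  have h_mem : (𝒰.map f : Filter 𝕜) ≤ 𝓟 (Metric.closedBall 0 r) := by
    rw [le_principal_iff]
    exact h.mono fun i hi => mem_closedBall_zero_iff.2 hi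
  obtain ⟨a, ha, hlim⟩ := (isCompact_closedBall (0 : 𝕜) r).ultrafilter_le_nhds _ h_mem
  exact ⟨a, mem_closedBall_zero_iff.1 ha, hlim⟩

lemma exists_ultralimit_bilinear {V W : Type*} [SeminormedAddCommGroup V] [NormedSpace 𝕜 V]
    [SeminormedAddCommGroup W] [NormedSpace 𝕜 W] {b : ι → V →ₗ[𝕜] W →ₗ[𝕜] 𝕜} {K : ℝ}
    (hK : 0 ≤ K) (hb : ∀ v w, ∀ᶠ i in 𝒰, ‖b i v w‖ ≤ K * ‖v‖ * ‖w‖) :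
    ∃ R : V →L[𝕜] StrongDual 𝕜 W, ‖R‖ ≤ K ∧
      ∀ v w, Tendsto (fun i => b i v w) 𝒰 (𝓝 (R v w)) := by
  choose L hL_norm hL using fun v w => exists_tendsto_ultrafilter_of_norm_le 𝒰 (hb v w)
  have L_eq {v w a} (h : Tendsto (fun i => b i v w) 𝒰 (𝓝 a)) : L v w = a :=
    tendsto_nhds_unique (hL v w) h
  refine ⟨LinearMap.mkContinuous₂ (LinearMap.mk₂ 𝕜 L ?_ ?_ ?_ ?_) K hL_norm,
    LinearMap.mkContinuous₂_norm_le _ hK _, hL⟩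
  · exact fun v v' w => L_eq (by simpa using (hL v w).add (hL v' w))
  · exact fun r v w => L_eq (by simpa using (hL v w).const_mul r)
  · exact fun v w w' => L_eq (by simpa using (hL v w).add (hL v w'))
  · exact fun r v w => L_eq (by simpa using (hL v w).const_mul r)

end Ultralimit

section Dual

set_option maxSynthPendingDepth 3

variable {Y : Type v} [NormedAddCommGroup Y] [NormedSpace 𝕜 Y]

lemma exists_ultralimit_dualOperator {X : Type*} [NormedAddCommGroup X] [NormedSpace 𝕜 X]
    {F : ℕ → Submodule 𝕜 Y} (hmono : Monotone F) (hF : ∀ y, ∃ n, y ∈ F n)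
    {J : ∀ n, F n →L[𝕜] X} {K : ℝ} (hJ : ∀ n, ‖J n‖ ≤ K) :
    ∃ R : StrongDual 𝕜 X →L[𝕜] StrongDual 𝕜 Y, ‖R‖ ≤ K ∧
      ∀ φ ψ, (∀ n (y : F n), φ (J n y) = ψ y) → R φ = ψ := by
  choose J' hJ' using fun n => (J n : F n →ₗ[𝕜] X).exists_extend
  have J'_apply {n : ℕ} (y : F n) : J' n y = J n y := LinearMap.congr_fun (hJ' n) y
  have eventually_mem (y : Y) : ∀ᶠ n in hyperfilter ℕ, y ∈ F n := by
    obtain ⟨n, hn⟩ := hF y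
    exact Nat.hyperfilter_le_atTop ((eventually_ge_atTop n).mono fun m hm => hmono hm hn)
  obtain ⟨R, hR_norm, hR⟩ := exists_ultralimit_bilinear (hyperfilter ℕ) (K := K)
    (b := fun n => (ContinuousLinearMap.coeLM 𝕜 : StrongDual 𝕜 X →ₗ[𝕜] X →ₗ[𝕜] 𝕜).compl₂ (J' n))
    ((norm_nonneg _).trans (hJ 0)) fun φ y => by
      filter_upwards [eventually_mem y] with n hy
      calc ‖φ (J' n y)‖ = ‖φ (J n ⟨y, hy⟩)‖ := by rw [← J'_apply]
        _ ≤ ‖φ‖ * (K * ‖y‖) := φ.le_opNorm_of_le ((J n).le_of_opNorm_le (hJ n) ⟨y, hy⟩)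
        _ = K * ‖φ‖ * ‖y‖ := by ring
  refine ⟨R, hR_norm, fun φ ψ h => ContinuousLinearMap.ext fun y =>
    tendsto_nhds_unique (hR φ y) (tendsto_const_nhds.congr' ?_)⟩
  filter_upwards [eventually_mem y] with n hy
  exact (h n ⟨y, hy⟩).symm.trans (congrArg φ (J'_apply ⟨y, hy⟩).symm)

variable {ι : Type*} {G : ι → Type w} [∀ i, NormedAddCommGroup (G i)] [∀ i, NormedSpace 𝕜 (G i)]

variable (𝕜) in
/-- The restriction of bounded sequences along `l`, as bounded families. -/
def boundedReindex (l : ι → ℕ) : BoundedContinuousFunction ℕ 𝕜 →ₗ[𝕜] lp (fun _ : ι => 𝕜) ∞ where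
  toFun a := ⟨fun i => a (l i), memℓp_infty ⟨‖a‖, Set.forall_mem_range.2 fun i =>
    a.norm_coe_le_norm (l i)⟩⟩
  map_add' _ _ := rfl
  map_smul' _ _ := rfl

lemma boundedReindex_apply (l : ι → ℕ) (a : BoundedContinuousFunction ℕ 𝕜) (i : ι) :
    boundedReindex 𝕜 l a i = a (l i) := rfl

lemma norm_boundedReindex_le (l : ι → ℕ) (a : BoundedContinuousFunction ℕ 𝕜) :
    ‖boundedReindex 𝕜 l a‖ ≤ ‖a‖ :=
  lp.norm_le_of_forall_le (norm_nonneg a) fun i => a.norm_coe_le_norm (l i)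

/-- For a family of contractions `A i : G i → H` into a Banach space and a bounded family of scalars
`a`, the operator `x ↦ ∑' i, a i • A i (x i)` on the `ℓ¹`-sum of the `G i`. -/
def diagonalSum {H : Type*} [NormedAddCommGroup H] [NormedSpace 𝕜 H] [CompleteSpace H]
    (A : ∀ i, G i →L[𝕜] H) (hA : ∀ i, ‖A i‖ ≤ 1) :
    lp (fun _ : ι => 𝕜) ∞ →L[𝕜] lp G 1 →L[𝕜] H :=
  lp.dualPairing ∞ 1 (K := 1) (fun i => ContinuousLinearMap.toSpanSingleton 𝕜 (A i)) fun i =>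
    (ContinuousLinearMap.norm_toSpanSingleton (A i)).trans_le (hA i)

lemma norm_diagonalSum_le {H : Type*} [NormedAddCommGroup H] [NormedSpace 𝕜 H] [CompleteSpace H]
    {A : ∀ i, G i →L[𝕜] H} (hA : ∀ i, ‖A i‖ ≤ 1) (a : lp (fun _ : ι => 𝕜) ∞) :
    ‖diagonalSum A hA a‖ ≤ ‖a‖ :=
  (ContinuousLinearMap.le_of_opNorm_le _ (lp.norm_dualPairing _ _) a).trans_eq (one_mul _)

lemma diagonalSum_single {H : Type*} [NormedAddCommGroup H] [NormedSpace 𝕜 H] [CompleteSpace H]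
    [DecidableEq ι] {A : ∀ i, G i →L[𝕜] H} (hA : ∀ i, ‖A i‖ ≤ 1) (a : lp (fun _ : ι => 𝕜) ∞)
    (i : ι) (x : G i) : diagonalSum A hA a (lp.single 1 i x) = a i • A i x := by
  rw [diagonalSum, lp.dualPairing_apply, tsum_eq_single i fun j hj => by simp [hj]]
  simp

lemma norm_inclusionInDoubleDual_comp_le {V : Type*} [NormedAddCommGroup V] [NormedSpace 𝕜 V]
    (A : V →L[𝕜] Y) : ‖(NormedSpace.inclusionInDoubleDual 𝕜 Y).comp A‖ ≤ ‖A‖ :=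
  (ContinuousLinearMap.opNorm_comp_le _ _).trans
    (mul_le_of_le_one_left (norm_nonneg _) (NormedSpace.inclusionInDoubleDual_norm_le 𝕜 Y))

/-- For a family of contractions `A i : G i → Y` and a bounded family of scalars `a`, the operator
taking `ψ` to the functional `x ↦ ∑' i, a i * ψ (A i (x i))` on the `ℓ¹`-sum of the `G i`. The sum
is formed in the bidual of `Y`, since `Y` need not be complete. -/
def diagonalDual (A : ∀ i, G i →L[𝕜] Y) (hA : ∀ i, ‖A i‖ ≤ 1) :
    lp (fun _ : ι => 𝕜) ∞ →ₗ[𝕜] StrongDual 𝕜 Y →L[𝕜] StrongDual 𝕜 (lp G 1) :=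
  (ContinuousLinearMap.flipₗᵢ 𝕜 (lp G 1) (StrongDual 𝕜 Y) 𝕜).toLinearEquiv.toLinearMap ∘ₗ
    (diagonalSum (fun i => (NormedSpace.inclusionInDoubleDual 𝕜 Y).comp (A i))
      fun i => (norm_inclusionInDoubleDual_comp_le (A i)).trans (hA i)).toLinearMap

variable {A : ∀ i, G i →L[𝕜] Y}

lemma norm_diagonalDual_le (hA : ∀ i, ‖A i‖ ≤ 1) (a : lp (fun _ : ι => 𝕜) ∞) :
    ‖diagonalDual A hA a‖ ≤ ‖a‖ :=
  ((ContinuousLinearMap.flipₗᵢ 𝕜 (lp G 1) (StrongDual 𝕜 Y) 𝕜).norm_map _).trans_le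
    (norm_diagonalSum_le _ a)

lemma diagonalDual_single [DecidableEq ι] (hA : ∀ i, ‖A i‖ ≤ 1) (a : lp (fun _ : ι => 𝕜) ∞)
    (ψ : StrongDual 𝕜 Y) (i : ι) (x : G i) :
    diagonalDual A hA a ψ (lp.single 1 i x) = a i * ψ (A i x) :=
  DFunLike.congr_fun (F := StrongDual 𝕜 (StrongDual 𝕜 Y))
    (diagonalSum_single (A := fun i => (NormedSpace.inclusionInDoubleDual 𝕜 Y).comp (A i)) _ a i x)
    ψ

lemma exists_disjoint_complemented_duals_of_factorizations
    {F : ℕ → Submodule 𝕜 Y} (hmono : Monotone F) (hF : ∀ y, ∃ n, y ∈ F n)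
    (hA : ∀ i, ‖A i‖ ≤ 1) {l : ι → ℕ} {m : ℕ → ℕ → ι} (hlm : ∀ k n, l (m k n) = k)
    {J : ∀ k n, F n →L[𝕜] G (m k n)} {K : ℝ} (hJ : ∀ k n, ‖J k n‖ ≤ K)
    (hAJ : ∀ k n y, A (m k n) (J k n y) = y) :
    ∃ (B : BoundedContinuousFunction ℕ 𝕜 →ₗ[𝕜] StrongDual 𝕜 Y →L[𝕜] StrongDual 𝕜 (lp G 1))
      (R : ℕ → StrongDual 𝕜 (lp G 1) →L[𝕜] StrongDual 𝕜 Y),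
      (∀ a, ‖B a‖ ≤ ‖a‖) ∧ (∀ k, ‖R k‖ ≤ K) ∧ ∀ k a ψ, R k (B a ψ) = a k • ψ := by
  classical
  let toSum (k n : ℕ) : F n →L[𝕜] lp G 1 :=
    (lp.singleContinuousLinearMap 𝕜 G 1 (m k n)).comp (J k n)
  have norm_toSum_le (k n : ℕ) : ‖toSum k n‖ ≤ K :=
    (toSum k n).opNorm_le_bound ((norm_nonneg _).trans (hJ k n)) fun y =>
      (lp.norm_single zero_lt_one (m k n) _).trans_le ((J k n).le_of_opNorm_le (hJ k n) y)
  choose R hR_norm hR using fun k => exists_ultralimit_dualOperator hmono hF (norm_toSum_le k)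
  refine ⟨diagonalDual A hA ∘ₗ boundedReindex 𝕜 l, R, fun a => ?_, hR_norm,
    fun k a ψ => hR k _ _ fun n y => ?_⟩
  · exact (norm_diagonalDual_le hA _).trans (norm_boundedReindex_le l a)
  · refine (diagonalDual_single hA _ ψ (m k n) (J k n y)).trans ?_
    rw [boundedReindex_apply, hlm, hAJ]
    rfl

end Dual

/-! ### Johnson's space -/

section Johnson

variable {E : ℕ → Type v} [∀ n, NormedAddCommGroup (E n)] [∀ n, NormedSpace 𝕜 (E n)]

lemma exists_normalized_iso_of_banachMazurDist_lt {V : Type v} {W : Type w} [NormedAddCommGroup V]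
    [NormedSpace 𝕜 V] [NormedAddCommGroup W] [NormedSpace 𝕜 W] [Nontrivial W] {c : ℝ}
    (h : banachMazurDist 𝕜 V W < ENNReal.ofReal c) :
    ∃ (A : V →L[𝕜] W) (J : W →L[𝕜] V), (∀ y, A (J y) = y) ∧ ‖A‖ ≤ 1 ∧ ‖J‖ ≤ c := by
  obtain ⟨T, hT⟩ := iInf_lt_iff.1 h
  have T_ne_zero : (T : V →L[𝕜] W) ≠ 0 := fun hT_zero => by
    obtain ⟨w, hw⟩ := exists_ne (0 : W)
    exact hw ((T.apply_symm_apply w).symm.trans (DFunLike.congr_fun hT_zero (T.symm w)))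
  set t : ℝ := ‖(T : V →L[𝕜] W)‖
  have t_pos : 0 < t := norm_pos_iff.2 T_ne_zero
  have norm_t : ‖(t : 𝕜)‖ = t := RCLike.norm_of_nonneg t_pos.le
  have t_ne_zero : (t : 𝕜) ≠ 0 := RCLike.ofReal_ne_zero.2 t_pos.ne'
  refine ⟨(t : 𝕜)⁻¹ • (T : V →L[𝕜] W), (t : 𝕜) • (T.symm : W →L[𝕜] V), fun y => ?_, ?_, ?_⟩
  · simp [t_ne_zero]
  · rw [norm_smul, norm_inv, norm_t]
    exact (inv_mul_cancel₀ t_pos.ne').le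
  · rw [norm_smul, norm_t]
    exact (ENNReal.ofReal_lt_ofReal_iff'.1 hT).1.le

variable {Y : Type u} [NormedAddCommGroup Y] [NormedSpace 𝕜 Y] {F : ℕ → Submodule 𝕜 Y}
  [∀ n, FiniteDimensional 𝕜 (F n)] [∀ n, Nontrivial (F n)] {σ : ℕ → ℕ}

lemma exists_contraction_through_subspace (hE : BanachMazurDense 𝕜 E) (n : ℕ) :
    ∃ (e : ℕ) (A : E e →L[𝕜] Y) (J : F n →L[𝕜] E e),
      ‖A‖ ≤ 1 ∧ ‖J‖ ≤ 2 ∧ ∀ y, A (J y) = y := by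
  obtain ⟨e, he⟩ := hE (F n) (ENNReal.ofReal 2) (by norm_num)
  obtain ⟨A, J, hAJ, hA, hJ⟩ := exists_normalized_iso_of_banachMazurDist_lt he
  refine ⟨e, (F n).subtypeL.comp A, J, ?_, hJ, fun y => congrArg Subtype.val (hAJ y)⟩
  exact ContinuousLinearMap.opNorm_le_bound _ zero_le_one (A.le_of_opNorm_le hA)

lemma exists_injective_listing (hσ : ∀ n, {m | σ m = n}.Infinite) (e : ℕ → ℕ) :
    ∃ m : ℕ × ℕ → ℕ, Function.Injective m ∧ ∀ p, σ (m p) = e p.2 := by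
  obtain ⟨μ, hμ, hσμ⟩ := extraction_forall_of_frequently
    (P := fun t i => σ i = e (Nat.unpair t).2)
    fun t => Nat.frequently_atTop_iff_infinite.2 (hσ _)
  exact ⟨fun p => μ (Nat.pairEquiv p), hμ.injective.comp Nat.pairEquiv.injective,
    fun p => (hσμ _).trans (congrArg (fun r => e r.2) (Nat.pairEquiv.symm_apply_apply p))⟩

theorem exists_disjoint_complemented_duals (hE : BanachMazurDense 𝕜 E)
    (hσ : ∀ n, {m | σ m = n}.Infinite) (hmono : Monotone F) (hF : ∀ y, ∃ n, y ∈ F n) :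
    ∃ (B : BoundedContinuousFunction ℕ 𝕜 →ₗ[𝕜]
        StrongDual 𝕜 Y →L[𝕜] StrongDual 𝕜 (JohnsonC1 E σ))
      (R : ℕ → StrongDual 𝕜 (JohnsonC1 E σ) →L[𝕜] StrongDual 𝕜 Y),
      (∀ a, ‖B a‖ ≤ ‖a‖) ∧ (∀ k, ‖R k‖ ≤ 2) ∧ ∀ k a ψ, R k (B a ψ) = a k • ψ := by
  choose e A₀ J₀ hA₀ hJ₀ hAJ₀ using exists_contraction_through_subspace (F := F) hE
  obtain ⟨m, hm, hσm⟩ := exists_injective_listing hσ e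
  have h_component (i : ℕ) : ∃ A : E (σ i) →L[𝕜] Y, ‖A‖ ≤ 1 ∧ ∀ p, m p = i →
      ∃ J : F p.2 →L[𝕜] E (σ i), ‖J‖ ≤ 2 ∧ ∀ y, A (J y) = y := by
    by_cases hi : ∃ p, m p = i
    · obtain ⟨p, rfl⟩ := hi
      rw [hσm]
      refine ⟨A₀ p.2, hA₀ p.2, fun p' hp' => ?_⟩
      obtain rfl := hm hp'
      exact ⟨J₀ p'.2, hJ₀ p'.2, hAJ₀ p'.2⟩
    · exact ⟨0, by simp, fun p hp => absurd ⟨p, hp⟩ hi⟩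
  choose A hA hAJ using h_component
  choose J hJ hAJ using fun k n => hAJ (m (k, n)) (k, n) rfl
  exact exists_disjoint_complemented_duals_of_factorizations hmono hF hA
    (l := fun i => (Function.invFun m i).1) (m := fun k n => m (k, n))
    (fun k n => by rw [Function.leftInverse_invFun hm]) hJ hAJ

end Johnson

/-! ### Coefficient spaces of unimodular systems -/

/-- Two sequences of unimodular matrices, `lower k` with columns of level `k` and `upper k` with
columns of level `k + 1`, such that for each `k` all the columns of `lower k` and `upper k`
together are orthogonal. -/
structure UnimodularSystem (𝕜 : Type u) [RCLike 𝕜] where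
  Col : ℕ → Type
  Row : ℕ → Type
  [fintypeCol : ∀ k, Fintype (Col k)]
  [decidableEqCol : ∀ k, DecidableEq (Col k)]
  [nonemptyCol : ∀ k, Nonempty (Col k)]
  [fintypeRow : ∀ k, Fintype (Row k)]
  [nonemptyRow : ∀ k, Nonempty (Row k)]
  lower : ∀ k, Matrix (Row k) (Col k) 𝕜
  upper : ∀ k, Matrix (Row k) (Col (k + 1)) 𝕜
  norm_lower : ∀ k g y, ‖lower k g y‖ = 1
  norm_upper : ∀ k g y, ‖upper k g y‖ = 1
  conjTranspose_lower_mul_lower : ∀ k, (lower k)ᴴ * lower k = (Fintype.card (Row k) : 𝕜) • 1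
  conjTranspose_upper_mul_upper : ∀ k, (upper k)ᴴ * upper k = (Fintype.card (Row k) : 𝕜) • 1
  conjTranspose_lower_mul_upper : ∀ k, (lower k)ᴴ * upper k = 0

namespace UnimodularSystem

attribute [instance] fintypeCol decidableEqCol nonemptyCol fintypeRow nonemptyRow

variable (S : UnimodularSystem 𝕜)

/-- The normalized inner products of distinct rows of `lower k`, of distinct rows of `upper k`, and
of rows of `lower (k + 1)` with rows of `upper k`, decay like `q ^ k`. -/
structure IsIncoherent (q : ℝ) : Prop where
  norm_expect_lower_le : ∀ k {g h}, g ≠ h →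
    ‖𝔼 y, S.lower k g y * conj (S.lower k h y)‖ ≤ q ^ k
  norm_expect_upper_le : ∀ k {g h}, g ≠ h →
    ‖𝔼 y, S.upper k g y * conj (S.upper k h y)‖ ≤ q ^ k
  norm_expect_lower_upper_le : ∀ k g h,
    ‖𝔼 y, S.lower (k + 1) g y * conj (S.upper k h y)‖ ≤ q ^ (k + 1)

variable {S} in
lemma card_row_ne_zero (k : ℕ) : (Fintype.card (S.Row k) : 𝕜) ≠ 0 :=
  Nat.cast_ne_zero.2 Fintype.card_ne_zero

lemma conjTranspose_upper_mul_lower (k : ℕ) : (S.upper k)ᴴ * S.lower k = 0 := by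
  simpa using congrArg Matrix.conjTranspose (S.conjTranspose_lower_mul_upper k)

end UnimodularSystem

/-- Families of coefficients indexed by the columns of `S`, vanishing at all but finitely many
levels. They are normed by the supremum over the rows of `S` of their values, the values at level
`l` being weighted by `(1 + s) ^ l`. -/
def CoefSpace (S : UnimodularSystem 𝕜) (_s : ℝ≥0) : Type u := Π₀ k, S.Col k → 𝕜

namespace CoefSpace

open UnimodularSystem

variable {S : UnimodularSystem 𝕜} {s : ℝ≥0}

instance : AddCommGroup (CoefSpace S s) := inferInstanceAs (AddCommGroup (Π₀ k, S.Col k → 𝕜))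
instance : Module 𝕜 (CoefSpace S s) := inferInstanceAs (Module 𝕜 (Π₀ k, S.Col k → 𝕜))

/-- The coefficients of level `k`. -/
def level (k : ℕ) : CoefSpace S s →ₗ[𝕜] (S.Col k → 𝕜) :=
  DFinsupp.lapply (M := fun k => S.Col k → 𝕜) k

lemma ext_level {c d : CoefSpace S s} (h : ∀ k, level k c = level k d) : c = d := DFinsupp.ext h

lemma exists_forall_lt_level_eq_zero (c : CoefSpace S s) : ∃ n, ∀ k, n < k → level k c = 0 := by
  obtain ⟨n, hn⟩ := (DFinsupp.finite_support c).bddAbove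
  exact ⟨n, fun k hk => by_contra fun h => (hn h).not_gt hk⟩

/-- The values of a coefficient family at the rows of level `l`. -/
def eval (l : ℕ) : CoefSpace S s →ₗ[𝕜] (S.Row l → 𝕜) :=
  (S.lower l).mulVecLin ∘ₗ level l + (S.upper l).mulVecLin ∘ₗ level (l + 1)

lemma eval_apply (l : ℕ) (c : CoefSpace S s) :
    eval l c = S.lower l *ᵥ level l c + S.upper l *ᵥ level (l + 1) c := rfl

lemma conjTranspose_lower_mulVec_eval (l : ℕ) (c : CoefSpace S s) :
    (S.lower l)ᴴ *ᵥ eval l c = (Fintype.card (S.Row l) : 𝕜) • level l c := by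
  rw [eval_apply, Matrix.mulVec_add, Matrix.mulVec_mulVec, Matrix.mulVec_mulVec,
    S.conjTranspose_lower_mul_lower, S.conjTranspose_lower_mul_upper, Matrix.zero_mulVec, add_zero,
    Matrix.smul_mulVec, Matrix.one_mulVec]

lemma conjTranspose_upper_mulVec_eval (l : ℕ) (c : CoefSpace S s) :
    (S.upper l)ᴴ *ᵥ eval l c = (Fintype.card (S.Row l) : 𝕜) • level (l + 1) c := by
  rw [eval_apply, Matrix.mulVec_add, Matrix.mulVec_mulVec, Matrix.mulVec_mulVec,
    S.conjTranspose_upper_mul_upper, S.conjTranspose_upper_mul_lower, Matrix.zero_mulVec, zero_add,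
    Matrix.smul_mulVec, Matrix.one_mulVec]

variable (S s) in
/-- The weighted values of a coefficient family, as a bounded function on the rows. -/
def toBounded : CoefSpace S s →ₗ[𝕜] lp (fun _ : Σ l, S.Row l => 𝕜) ∞ where
  toFun c := ⟨fun i => (((1 + s : ℝ) ^ i.1 : ℝ) : 𝕜) * eval i.1 c i.2, by
    obtain ⟨n, hn⟩ := c.exists_forall_lt_level_eq_zero
    change Memℓp (E := fun _ : Σ l, S.Row l => 𝕜) _ ∞
    refine (memℓp_zero ?_).of_exponent_ge zero_le
    refine ((Finset.range (n + 1)).sigma fun _ => Finset.univ).finite_toSet.subset fun i hi => ?_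
    simp only [Finset.coe_sigma, Set.mem_sigma_iff, Finset.coe_range, Set.mem_Iio,
      Finset.coe_univ, Set.mem_univ, and_true]
    by_contra! h
    refine hi ?_
    rw [eval_apply, hn _ (by omega), hn _ (by omega)]
    simp⟩
  map_add' c d := by
    refine lp.ext (funext fun i => ?_)
    exact (congrArg _ (congrFun (map_add (eval i.1) c d) i.2)).trans (mul_add _ _ _)
  map_smul' r c := by
    refine lp.ext (funext fun i => ?_)
    exact (congrArg _ (congrFun (map_smul (eval i.1) r c) i.2)).trans (mul_left_comm _ _ _)

lemma toBounded_apply (c : CoefSpace S s) (i : Σ l, S.Row l) :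
    toBounded S s c i = (((1 + s : ℝ) ^ i.1 : ℝ) : 𝕜) * eval i.1 c i.2 := rfl

lemma norm_toBounded_apply (c : CoefSpace S s) (i : Σ l, S.Row l) :
    ‖toBounded S s c i‖ = (1 + s : ℝ) ^ i.1 * ‖eval i.1 c i.2‖ := by
  rw [toBounded_apply, norm_mul, RCLike.norm_ofReal, abs_of_nonneg (by positivity)]

lemma toBounded_injective : Function.Injective (toBounded S s) := by
  refine (injective_iff_map_eq_zero _).2 fun c hc => ext_level fun k => ?_
  have eval_eq_zero : eval k c = 0 := funext fun g => by
    have h := norm_toBounded_apply c ⟨k, g⟩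
    rw [hc, lp.coeFn_zero, Pi.zero_apply, norm_zero, zero_eq_mul] at h
    exact norm_eq_zero.1 (h.resolve_left (by positivity))
  have h := conjTranspose_lower_mulVec_eval k c
  rw [eval_eq_zero, Matrix.mulVec_zero, eq_comm] at h
  exact (smul_eq_zero_iff_right (card_row_ne_zero k)).1 h

instance : NormedAddCommGroup (CoefSpace S s) :=
  NormedAddCommGroup.induced _ _ (toBounded S s) toBounded_injective

instance : NormedSpace 𝕜 (CoefSpace S s) := NormedSpace.induced 𝕜 _ _ (toBounded S s)

variable (S s) in
/-- The map `CoefSpace.toBounded` as a linear isometry. -/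
def toBoundedₗᵢ : CoefSpace S s →ₗᵢ[𝕜] lp (fun _ : Σ l, S.Row l => 𝕜) ∞ where
  toLinearMap := toBounded S s
  norm_map' _ := rfl

lemma weight_mul_norm_eval_le (l : ℕ) (g : S.Row l) (c : CoefSpace S s) :
    (1 + s : ℝ) ^ l * ‖eval l c g‖ ≤ ‖c‖ :=
  (norm_toBounded_apply c ⟨l, g⟩).symm.trans_le
    (lp.norm_apply_le_norm ENNReal.top_ne_zero (toBounded S s c) ⟨l, g⟩)

lemma norm_le_of_forall {c : CoefSpace S s} {C : ℝ} (hC : 0 ≤ C)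
    (h : ∀ l g, (1 + s : ℝ) ^ l * ‖eval l c g‖ ≤ C) : ‖c‖ ≤ C :=
  lp.norm_le_of_forall_le (f := toBounded S s c) hC fun i =>
    (norm_toBounded_apply c i).trans_le (h i.1 i.2)

lemma one_le_weight (l : ℕ) : (1 : ℝ) ≤ (1 + s) ^ l := one_le_pow₀ (by simp)

lemma norm_eval_le (l : ℕ) (g : S.Row l) (c : CoefSpace S s) : ‖eval l c g‖ ≤ ‖c‖ :=
  (le_mul_of_one_le_left (norm_nonneg _) (one_le_weight l)).trans (weight_mul_norm_eval_le l g c)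

variable (S s) in
/-- Evaluation at a row as a bounded functional. -/
def evalDual (l : ℕ) (g : S.Row l) : StrongDual 𝕜 (CoefSpace S s) :=
  (LinearMap.proj g ∘ₗ eval l).mkContinuous 1 fun c => by
    rw [one_mul]; exact norm_eval_le l g c

lemma evalDual_apply (l : ℕ) (g : S.Row l) (c : CoefSpace S s) :
    evalDual S s l g c = eval l c g := rfl

lemma norm_evalDual_le (l : ℕ) (g : S.Row l) : ‖evalDual S s l g‖ ≤ 1 :=
  LinearMap.mkContinuous_norm_le _ zero_le_one _

lemma sum_norm_eval_sq (l : ℕ) (c : CoefSpace S s) :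
    ∑ g, ‖eval l c g‖ ^ 2 = Fintype.card (S.Row l) *
      (∑ y, ‖level l c y‖ ^ 2 + ∑ y, ‖level (l + 1) c y‖ ^ 2) := by
  have star_dotProduct_self : ∀ {ι : Type} [Fintype ι] (a : ι → 𝕜),
      star a ⬝ᵥ a = ((∑ i, ‖a i‖ ^ 2 : ℝ) : 𝕜) := fun a => by
    simp [dotProduct, RCLike.conj_mul]
  have h : star (eval l c) ⬝ᵥ eval l c = (Fintype.card (S.Row l) : 𝕜) *
      (star (level l c) ⬝ᵥ level l c + star (level (l + 1) c) ⬝ᵥ level (l + 1) c) := by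
    nth_rewrite 1 [eval_apply]
    rw [star_add, add_dotProduct, Matrix.star_mulVec, Matrix.star_mulVec,
      ← Matrix.dotProduct_mulVec, ← Matrix.dotProduct_mulVec, conjTranspose_lower_mulVec_eval,
      conjTranspose_upper_mulVec_eval, dotProduct_smul, dotProduct_smul, smul_eq_mul, smul_eq_mul,
      mul_add]
  simp only [star_dotProduct_self] at h
  exact_mod_cast h

lemma sum_norm_level_sq_le (k : ℕ) (c : CoefSpace S s) : ∑ y, ‖level k c y‖ ^ 2 ≤ ‖c‖ ^ 2 := by
  have card_pos : (0 : ℝ) < Fintype.card (S.Row k) := Nat.cast_pos.2 Fintype.card_pos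
  refine le_of_mul_le_mul_left ?_ card_pos
  calc Fintype.card (S.Row k) * ∑ y, ‖level k c y‖ ^ 2
      ≤ ∑ g, ‖eval k c g‖ ^ 2 := by
        rw [sum_norm_eval_sq]
        gcongr
        exact le_add_of_nonneg_right (by positivity)
    _ ≤ ∑ _g : S.Row k, ‖c‖ ^ 2 := by gcongr with g; exact norm_eval_le k g c
    _ = Fintype.card (S.Row k) * ‖c‖ ^ 2 := by simp

lemma norm_level_le (k : ℕ) (c : CoefSpace S s) (y : S.Col k) : ‖level k c y‖ ≤ ‖c‖ := by
  refine le_of_sq_le_sq ?_ (norm_nonneg _)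
  exact (Finset.single_le_sum (f := fun y => ‖level k c y‖ ^ 2) (fun _ _ => by positivity)
    (Finset.mem_univ y)).trans (sum_norm_level_sq_le k c)

lemma sum_norm_level_le (k : ℕ) (c : CoefSpace S s) :
    ∑ y, ‖level k c y‖ ≤ √(Fintype.card (S.Col k)) * ‖c‖ := by
  refine le_of_sq_le_sq ?_ (by positivity)
  rw [mul_pow, Real.sq_sqrt (by positivity)]
  exact sq_sum_le_card_mul_sum_sq.trans
    (mul_le_mul_of_nonneg_left (sum_norm_level_sq_le k c) (by positivity))

variable (S s) in
/-- The coefficient functionals. -/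
def coefDual (k : ℕ) (y : S.Col k) : StrongDual 𝕜 (CoefSpace S s) :=
  (LinearMap.proj y ∘ₗ level k).mkContinuous 1 fun c => by
    rw [one_mul]; exact norm_level_le k c y

lemma coefDual_apply (k : ℕ) (y : S.Col k) (c : CoefSpace S s) :
    coefDual S s k y c = level k c y := rfl

lemma norm_coefDual_le (k : ℕ) (y : S.Col k) : ‖coefDual S s k y‖ ≤ 1 :=
  LinearMap.mkContinuous_norm_le _ zero_le_one _

lemma card_smul_coefDual (k : ℕ) (y : S.Col k) :
    (Fintype.card (S.Row k) : 𝕜) • coefDual S s k y =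
      ∑ g, conj (S.lower k g y) • evalDual S s k g := by
  ext c
  have h := congrFun (conjTranspose_lower_mulVec_eval k c) y
  simp only [Matrix.mulVec, dotProduct, Matrix.conjTranspose_apply, Pi.smul_apply] at h
  simpa [coefDual_apply, evalDual_apply] using h.symm

lemma card_smul_coefDual_succ (k : ℕ) (y : S.Col (k + 1)) :
    (Fintype.card (S.Row k) : 𝕜) • coefDual S s (k + 1) y =
      ∑ g, conj (S.upper k g y) • evalDual S s k g := by
  ext c
  have h := congrFun (conjTranspose_upper_mulVec_eval k c) y
  simp only [Matrix.mulVec, dotProduct, Matrix.conjTranspose_apply, Pi.smul_apply] at h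
  simpa [coefDual_apply, evalDual_apply] using h.symm

lemma norm_sum_smul_coefDual_le (k : ℕ) {a : S.Col k → 𝕜} {C : ℝ} (hC : 0 ≤ C)
    (ha : ∀ y, ‖a y‖ ≤ C) :
    ‖∑ y, a y • coefDual S s k y‖ ≤ C * √(Fintype.card (S.Col k)) := by
  refine ContinuousLinearMap.opNorm_le_bound _ (by positivity) fun c => ?_
  calc ‖(∑ y, a y • coefDual S s k y) c‖
      = ‖∑ y, a y * level k c y‖ := by simp [coefDual_apply]
    _ ≤ ∑ y, C * ‖level k c y‖ := norm_sum_le_of_le _ fun y _ => by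
        rw [norm_mul]
        exact mul_le_mul_of_nonneg_right (ha y) (norm_nonneg _)
    _ ≤ C * √(Fintype.card (S.Col k)) * ‖c‖ := by
        rw [← Finset.mul_sum, mul_assoc]
        exact mul_le_mul_of_nonneg_left (sum_norm_level_le k c) hC

variable (S s) in
/-- The coefficient families supported in level `k`. -/
def ofLevel (k : ℕ) : (S.Col k → 𝕜) →ₗ[𝕜] CoefSpace S s :=
  DFinsupp.lsingle (M := fun k => S.Col k → 𝕜) k

lemma level_ofLevel_same (k : ℕ) (a : S.Col k → 𝕜) : level k (ofLevel S s k a) = a :=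
  DFinsupp.single_eq_same

lemma level_ofLevel_ne {k l : ℕ} (h : l ≠ k) (a : S.Col k → 𝕜) :
    level l (ofLevel S s k a) = 0 :=
  DFinsupp.single_eq_of_ne h

lemma eval_ofLevel_same (k : ℕ) (a : S.Col k → 𝕜) :
    eval k (ofLevel S s k a) = S.lower k *ᵥ a := by
  rw [eval_apply, level_ofLevel_same, level_ofLevel_ne k.succ_ne_self, Matrix.mulVec_zero,
    add_zero]

lemma eval_ofLevel_succ (k : ℕ) (a : S.Col (k + 1) → 𝕜) :
    eval k (ofLevel S s (k + 1) a) = S.upper k *ᵥ a := by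
  rw [eval_apply, level_ofLevel_same, level_ofLevel_ne k.succ_ne_self.symm, Matrix.mulVec_zero,
    zero_add]

lemma eval_ofLevel_ne {k l : ℕ} (h : l ≠ k) (h' : l + 1 ≠ k) (a : S.Col k → 𝕜) :
    eval l (ofLevel S s k a) = 0 := by
  rw [eval_apply, level_ofLevel_ne h, level_ofLevel_ne h', Matrix.mulVec_zero, Matrix.mulVec_zero,
    add_zero]

variable (S s) in
/-- The unit vectors of the coefficient space. -/
def unitVec (k : ℕ) (y : S.Col k) : CoefSpace S s := ofLevel S s k (Pi.single y 1)

lemma ofLevel_eq_sum (k : ℕ) (a : S.Col k → 𝕜) :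
    ofLevel S s k a = ∑ y, a y • unitVec S s k y := by
  simp only [unitVec, ← map_smul, ← map_sum, ← pi_eq_sum_univ']

lemma coefDual_unitVec (k : ℕ) (y : S.Col k) : coefDual S s k y (unitVec S s k y) = 1 := by
  rw [coefDual_apply, unitVec, level_ofLevel_same, Pi.single_eq_same]

lemma norm_unitVec_le (k : ℕ) (y : S.Col k) : ‖unitVec S s k y‖ ≤ (1 + s : ℝ) ^ k := by
  refine norm_le_of_forall (by positivity) fun l g => ?_
  rcases eq_or_ne l k with rfl | hlk
  · rw [unitVec, eval_ofLevel_same, Matrix.mulVec_single_one, Matrix.col_apply, S.norm_lower,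
      mul_one]
  rcases eq_or_ne (l + 1) k with rfl | hlk'
  · rw [unitVec, eval_ofLevel_succ, Matrix.mulVec_single_one, Matrix.col_apply, S.norm_upper,
      mul_one]
    exact pow_le_pow_right₀ (by simp) l.le_succ
  · rw [unitVec, eval_ofLevel_ne hlk hlk', Pi.zero_apply, norm_zero, mul_zero]
    positivity

end CoefSpace

lemma norm_expect_le_of_forall_le {ι : Type*} [Fintype ι] [Nonempty ι] {f : ι → 𝕜} {C : ℝ}
    (h : ∀ i, ‖f i‖ ≤ C) : ‖𝔼 i, f i‖ ≤ C :=
  (RCLike.norm_expect_le (K := 𝕜)).trans (Finset.expect_le Finset.univ_nonempty fun i _ => h i)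

lemma mulVec_card_inv_smul_star {m n : Type*} [Fintype n] (M : Matrix m n 𝕜) (a : n → 𝕜) (i : m) :
    (M *ᵥ ((Fintype.card n : 𝕜)⁻¹ • star a)) i = 𝔼 j, M i j * conj (a j) := by
  rw [Matrix.mulVec_smul, Pi.smul_apply, Fintype.expect_eq_sum_div_card, div_eq_inv_mul]
  rfl

namespace CoefSpace

open UnimodularSystem

variable {S : UnimodularSystem 𝕜} {s s' : ℝ≥0} {q : ℝ}

variable (S s) in
/-- The conjugate of the row `g` of `lower k`, normalized so that its value at `g` is `1`. -/
def lowerRow (k : ℕ) (g : S.Row k) : CoefSpace S s :=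
  ofLevel S s k ((Fintype.card (S.Col k) : 𝕜)⁻¹ • star (S.lower k g))

variable (S s) in
/-- The conjugate of the row `g` of `upper k`, normalized so that its value at `g` is `1`. -/
def upperRow (k : ℕ) (g : S.Row k) : CoefSpace S s :=
  ofLevel S s (k + 1) ((Fintype.card (S.Col (k + 1)) : 𝕜)⁻¹ • star (S.upper k g))

lemma map_lowerRow (φ : CoefSpace S s →ₗ[𝕜] 𝕜) (k : ℕ) (g : S.Row k) :
    φ (lowerRow S s k g) = 𝔼 y, conj (S.lower k g y) * φ (unitVec S s k y) := by
  simp [lowerRow, ofLevel_eq_sum, Fintype.expect_eq_sum_div_card, div_eq_inv_mul,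
    Finset.mul_sum]

lemma map_upperRow (φ : CoefSpace S s →ₗ[𝕜] 𝕜) (k : ℕ) (g : S.Row k) :
    φ (upperRow S s k g) = 𝔼 y, conj (S.upper k g y) * φ (unitVec S s (k + 1) y) := by
  simp [upperRow, ofLevel_eq_sum, Fintype.expect_eq_sum_div_card, div_eq_inv_mul,
    Finset.mul_sum]

lemma eval_lowerRow_self (k : ℕ) (g : S.Row k) : eval k (lowerRow S s k g) g = 1 := by
  rw [lowerRow, eval_ofLevel_same, mulVec_card_inv_smul_star]
  simp [RCLike.mul_conj, S.norm_lower]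

lemma eval_upperRow_self (k : ℕ) (g : S.Row k) : eval k (upperRow S s k g) g = 1 := by
  rw [upperRow, eval_ofLevel_succ, mulVec_card_inv_smul_star]
  simp [RCLike.mul_conj, S.norm_upper]

/- The normalized rows agree at `g`, which is why the difference is small: all other values are
controlled by the incoherence. -/
lemma norm_eval_upperRow_sub_lowerRow_le (hS : S.IsIncoherent q) (hq : 0 ≤ q) (hq1 : q ≤ 1)
    (k : ℕ) (g : S.Row k) (l : ℕ) (h : S.Row l) :
    ‖eval l (upperRow S s k g - lowerRow S s k g) h‖ ≤ 2 * q ^ k := by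
  have pow_succ_le : q ^ (k + 1) ≤ 2 * q ^ k := by
    rw [pow_succ']
    exact mul_le_mul_of_nonneg_right (hq1.trans one_le_two) (pow_nonneg hq k)
  rw [map_sub, Pi.sub_apply]
  rcases eq_or_ne l (k + 1) with rfl | hl
  · rw [upperRow, lowerRow, eval_ofLevel_same, eval_ofLevel_ne (by omega) (by omega),
      Pi.zero_apply, sub_zero, mulVec_card_inv_smul_star]
    exact (hS.norm_expect_lower_upper_le k h g).trans pow_succ_le
  rcases eq_or_ne l k with rfl | hlk
  · rcases eq_or_ne h g with rfl | hhg
    · rw [eval_lowerRow_self, eval_upperRow_self, sub_self, norm_zero]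
      positivity
    · rw [upperRow, lowerRow, eval_ofLevel_same, eval_ofLevel_succ, mulVec_card_inv_smul_star,
        mulVec_card_inv_smul_star, two_mul]
      exact norm_sub_le_of_le (hS.norm_expect_upper_le l hhg) (hS.norm_expect_lower_le l hhg)
  · rw [upperRow, eval_ofLevel_ne hl (by omega), Pi.zero_apply, zero_sub, norm_neg]
    rcases eq_or_ne (l + 1) k with rfl | hlk'
    · rw [lowerRow, eval_ofLevel_succ, mulVec_card_inv_smul_star, ← RCLike.norm_conj, map_expect]
      simp only [map_mul, RCLike.conj_conj, mul_comm (conj (S.upper l h _))]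
      exact (hS.norm_expect_lower_upper_le l g h).trans
        (le_mul_of_one_le_left (by positivity) one_le_two)
    · rw [lowerRow, eval_ofLevel_ne hlk hlk', Pi.zero_apply, norm_zero]
      positivity

lemma norm_upperRow_sub_lowerRow_le (hS : S.IsIncoherent q) (hq : 0 ≤ q) (hq1 : q ≤ 1) (k : ℕ)
    (g : S.Row k) :
    ‖upperRow S s k g - lowerRow S s k g‖ ≤ (1 + s : ℝ) ^ (k + 1) * (2 * q ^ k) := by
  refine norm_le_of_forall (by positivity) fun l h => ?_
  rcases le_or_gt l (k + 1) with hl | hl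
  · exact mul_le_mul (pow_le_pow_right₀ (by simp) hl)
      (norm_eval_upperRow_sub_lowerRow_le hS hq hq1 k g l h) (norm_nonneg _) (by positivity)
  · rw [upperRow, lowerRow, map_sub, eval_ofLevel_ne (by omega) (by omega),
      eval_ofLevel_ne (by omega) (by omega), sub_zero, Pi.zero_apply, norm_zero, mul_zero]
    positivity

lemma map_coefDual (φ : StrongDual 𝕜 (CoefSpace S s) →ₗ[𝕜] 𝕜) (k : ℕ) (y : S.Col k) :
    φ (coefDual S s k y) = 𝔼 g, conj (S.lower k g y) * φ (evalDual S s k g) := by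
  have h := congrArg φ (card_smul_coefDual (s := s) k y)
  rw [map_smul, map_sum, smul_eq_mul] at h
  rw [Fintype.expect_eq_sum_div_card, eq_div_iff (card_row_ne_zero k), mul_comm, h]
  simp only [map_smul, smul_eq_mul]

lemma map_coefDual_succ (φ : StrongDual 𝕜 (CoefSpace S s) →ₗ[𝕜] 𝕜) (k : ℕ) (y : S.Col (k + 1)) :
    φ (coefDual S s (k + 1) y) = 𝔼 g, conj (S.upper k g y) * φ (evalDual S s k g) := by
  have h := congrArg φ (card_smul_coefDual_succ (s := s) k y)
  rw [map_smul, map_sum, smul_eq_mul] at h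
  rw [Fintype.expect_eq_sum_div_card, eq_div_iff (card_row_ne_zero k), mul_comm, h]
  simp only [map_smul, smul_eq_mul]

/-! ### Normalized traces -/

/-- The trace, normalized and restricted to the level `k`, of an operator between the duals of two
coefficient spaces. -/
def levelTrace (k : ℕ) :
    (StrongDual 𝕜 (CoefSpace S s) →L[𝕜] StrongDual 𝕜 (CoefSpace S s')) →ₗ[𝕜] 𝕜 where
  toFun T := 𝔼 y, T (coefDual S s k y) (unitVec S s' k y)
  map_add' T T' := by simp [Finset.expect_add_distrib]
  map_smul' r T := by simp [Finset.mul_expect]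

lemma levelTrace_apply (k : ℕ)
    (T : StrongDual 𝕜 (CoefSpace S s) →L[𝕜] StrongDual 𝕜 (CoefSpace S s')) :
    levelTrace k T = 𝔼 y, T (coefDual S s k y) (unitVec S s' k y) := rfl

lemma levelTrace_eq_expect_lowerRow (k : ℕ)
    (T : StrongDual 𝕜 (CoefSpace S s) →L[𝕜] StrongDual 𝕜 (CoefSpace S s')) :
    levelTrace k T = 𝔼 g, T (evalDual S s k g) (lowerRow S s' k g) := by
  have expand_coefDual (y) : T (coefDual S s k y) (unitVec S s' k y) =
      𝔼 g, conj (S.lower k g y) * T (evalDual S s k g) (unitVec S s' k y) :=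
    map_coefDual (T.flip (unitVec S s' k y) : StrongDual 𝕜 (CoefSpace S s) →ₗ[𝕜] 𝕜) k y
  have expand_lowerRow (g) : T (evalDual S s k g) (lowerRow S s' k g) =
      𝔼 y, conj (S.lower k g y) * T (evalDual S s k g) (unitVec S s' k y) :=
    map_lowerRow (T (evalDual S s k g) : CoefSpace S s' →ₗ[𝕜] 𝕜) k g
  simp only [levelTrace_apply, expand_coefDual, expand_lowerRow]
  exact Finset.expect_comm _ _ _

lemma levelTrace_succ_eq_expect_upperRow (k : ℕ)
    (T : StrongDual 𝕜 (CoefSpace S s) →L[𝕜] StrongDual 𝕜 (CoefSpace S s')) :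
    levelTrace (k + 1) T = 𝔼 g, T (evalDual S s k g) (upperRow S s' k g) := by
  have expand_coefDual (y) : T (coefDual S s (k + 1) y) (unitVec S s' (k + 1) y) =
      𝔼 g, conj (S.upper k g y) * T (evalDual S s k g) (unitVec S s' (k + 1) y) :=
    map_coefDual_succ (T.flip (unitVec S s' (k + 1) y) : StrongDual 𝕜 (CoefSpace S s) →ₗ[𝕜] 𝕜) k y
  have expand_upperRow (g) : T (evalDual S s k g) (upperRow S s' k g) =
      𝔼 y, conj (S.upper k g y) * T (evalDual S s k g) (unitVec S s' (k + 1) y) :=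
    map_upperRow (T (evalDual S s k g) : CoefSpace S s' →ₗ[𝕜] 𝕜) k g
  simp only [levelTrace_apply, expand_coefDual, expand_upperRow]
  exact Finset.expect_comm _ _ _

lemma norm_levelTrace_succ_sub_le (hS : S.IsIncoherent q) (hq : 0 ≤ q) (hq1 : q ≤ 1) (k : ℕ)
    (T : StrongDual 𝕜 (CoefSpace S s) →L[𝕜] StrongDual 𝕜 (CoefSpace S s')) :
    ‖levelTrace (k + 1) T - levelTrace k T‖ ≤ ‖T‖ * (2 * (1 + s')) * ((1 + s') * q) ^ k := by
  rw [levelTrace_succ_eq_expect_upperRow, levelTrace_eq_expect_lowerRow,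
    ← Finset.expect_sub_distrib]
  refine norm_expect_le_of_forall_le fun g => ?_
  rw [← map_sub]
  calc ‖T (evalDual S s k g) (upperRow S s' k g - lowerRow S s' k g)‖
      ≤ ‖T‖ * 1 * ((1 + s' : ℝ) ^ (k + 1) * (2 * q ^ k)) :=
        ContinuousLinearMap.le_of_opNorm_le_of_le _ (T.le_opNorm_of_le (norm_evalDual_le k g))
          (norm_upperRow_sub_lowerRow_le hS hq hq1 k g)
    _ = ‖T‖ * (2 * (1 + s')) * ((1 + s') * q) ^ k := by rw [mul_pow]; ring

lemma norm_levelTrace_zero_le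
    (T : StrongDual 𝕜 (CoefSpace S s) →L[𝕜] StrongDual 𝕜 (CoefSpace S s')) :
    ‖levelTrace 0 T‖ ≤ ‖T‖ :=
  norm_expect_le_of_forall_le fun y =>
    calc ‖T (coefDual S s 0 y) (unitVec S s' 0 y)‖ ≤ ‖T‖ * 1 * (1 + s' : ℝ) ^ 0 :=
          ContinuousLinearMap.le_of_opNorm_le_of_le _ (T.le_opNorm_of_le (norm_coefDual_le 0 y))
            (norm_unitVec_le 0 y)
      _ = ‖T‖ := by rw [pow_zero, mul_one, mul_one]

lemma exists_forall_norm_levelTrace_le (hS : S.IsIncoherent q) (hq : 0 ≤ q)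
    (hsq : (1 + s') * q < 1) :
    ∃ C : ℝ≥0, ∀ k (T : StrongDual 𝕜 (CoefSpace S s) →L[𝕜] StrongDual 𝕜 (CoefSpace S s')),
      ‖levelTrace k T‖ ≤ C * ‖T‖ := by
  have ratio_nonneg : 0 ≤ (1 + s') * q := by positivity
  have hq1 : q ≤ 1 := (le_mul_of_one_le_left hq (by simp)).trans hsq.le
  refine ⟨(1 + 2 * (1 + s') * (1 - (1 + s') * q)⁻¹).toNNReal, fun k T => ?_⟩
  have telescope : ‖levelTrace k T - levelTrace 0 T‖ ≤
      ∑ i ∈ Finset.range k, ‖T‖ * (2 * (1 + s')) * ((1 + s') * q) ^ i := by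
    rw [← dist_eq_norm, dist_comm]
    refine dist_le_range_sum_of_dist_le (f := fun i => levelTrace i T) k fun {i} _ => ?_
    rw [dist_comm, dist_eq_norm]
    exact norm_levelTrace_succ_sub_le hS hq hq1 i T
  have geometric : ∑ i ∈ Finset.range k, ((1 + s') * q) ^ i ≤ (1 - (1 + s') * q)⁻¹ :=
    sum_le_hasSum _ (fun i _ => pow_nonneg ratio_nonneg i)
      (hasSum_geometric_of_lt_one ratio_nonneg hsq)
  rw [Real.coe_toNNReal _ (by have := sub_pos.2 hsq; positivity)]
  calc ‖levelTrace k T‖ ≤ ‖levelTrace 0 T‖ + ‖levelTrace k T - levelTrace 0 T‖ :=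
        norm_le_insert' _ _
    _ ≤ ‖T‖ + ‖T‖ * (2 * (1 + s')) * (1 - (1 + s') * q)⁻¹ := by
        refine add_le_add (norm_levelTrace_zero_le T) (telescope.trans ?_)
        rw [← Finset.mul_sum]
        gcongr
    _ = (1 + 2 * (1 + s') * (1 - (1 + s') * q)⁻¹) * ‖T‖ := by ring

lemma norm_levelTrace_smulRight_le (f : StrongDual 𝕜 (StrongDual 𝕜 (CoefSpace S s)))
    (η : StrongDual 𝕜 (CoefSpace S s')) (k : ℕ) :
    ‖levelTrace k (f.smulRight η)‖ ≤
      ‖f‖ * ‖η‖ * ((1 + s' : ℝ) ^ k / √(Fintype.card (S.Col k))) := by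
  have levelTrace_eq : levelTrace k (f.smulRight η) =
      f (∑ y, η (unitVec S s' k y) • coefDual S s k y) / Fintype.card (S.Col k) := by
    simp [levelTrace_apply, Fintype.expect_eq_sum_div_card, mul_comm]
  have norm_le : ‖f (∑ y, η (unitVec S s' k y) • coefDual S s k y)‖ ≤
      ‖f‖ * (‖η‖ * (1 + s' : ℝ) ^ k * √(Fintype.card (S.Col k))) :=
    f.le_opNorm_of_le (norm_sum_smul_coefDual_le k (by positivity) fun y =>
      η.le_opNorm_of_le (norm_unitVec_le k y))
  rw [levelTrace_eq, norm_div, RCLike.norm_natCast]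
  refine (div_le_div_of_nonneg_right norm_le (by positivity)).trans_eq ?_
  rw [mul_div_assoc, mul_div_assoc, Real.sqrt_div_self', mul_one_div, mul_assoc, mul_div_assoc]

lemma tendsto_levelTrace_of_mem_finiteRankOperators
    (hcard : Tendsto (fun k => (1 + s' : ℝ) ^ k / √(Fintype.card (S.Col k))) atTop (𝓝 0))
    {T : StrongDual 𝕜 (CoefSpace S s) →L[𝕜] StrongDual 𝕜 (CoefSpace S s')}
    (hT : T ∈ finiteRankOperators 𝕜 _ _) : Tendsto (fun k => levelTrace k T) atTop (𝓝 0) := by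
  obtain ⟨n, f, η, rfl⟩ := exists_eq_sum_smulRight_of_mem_finiteRankOperators hT
  simp only [map_sum]
  rw [← Finset.sum_const_zero (s := (Finset.univ : Finset (Fin n)))]
  refine tendsto_finsetSum _ fun i _ =>
    squeeze_zero_norm (norm_levelTrace_smulRight_le (f i) (η i)) ?_
  simpa using hcard.const_mul (‖f i‖ * ‖η i‖)

lemma tendsto_levelTrace_of_mem_approximableOperators (hS : S.IsIncoherent q) (hq : 0 ≤ q)
    (hsq : (1 + s') * q < 1)
    (hcard : Tendsto (fun k => (1 + s' : ℝ) ^ k / √(Fintype.card (S.Col k))) atTop (𝓝 0))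
    {T : StrongDual 𝕜 (CoefSpace S s) →L[𝕜] StrongDual 𝕜 (CoefSpace S s')}
    (hT : T ∈ approximableOperators 𝕜 _ _) : Tendsto (fun k => levelTrace k T) atTop (𝓝 0) := by
  obtain ⟨C, hC⟩ := exists_forall_norm_levelTrace_le (s := s) hS hq hsq
  have h_lipschitz (k : ℕ) : LipschitzWith C
      fun T : StrongDual 𝕜 (CoefSpace S s) →L[𝕜] StrongDual 𝕜 (CoefSpace S s') =>
        levelTrace k T :=
    AddMonoidHomClass.lipschitz_of_bound_nnnorm (levelTrace (S := S) (s := s) (s' := s') k) C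
      fun T => NNReal.coe_le_coe.1 (by simpa using hC k T)
  have h_equicontinuous := (LipschitzWith.uniformEquicontinuous _ _ h_lipschitz).equicontinuous
  exact closure_minimal
    (fun _ hT' => tendsto_levelTrace_of_mem_finiteRankOperators hcard hT')
    (h_equicontinuous.isClosed_setOfPred_tendsto (f := fun _ => 0) continuous_const) hT

/-! ### A compact operator that is not approximable -/

variable (S s) in
/-- The identity map from the weighted to the unweighted coefficient space. -/
def unweight : CoefSpace S s →L[𝕜] CoefSpace S 0 :=
  LinearMap.mkContinuous
    ((LinearMap.id : (Π₀ k, S.Col k → 𝕜) →ₗ[𝕜] Π₀ k, S.Col k → 𝕜) :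
      CoefSpace S s →ₗ[𝕜] CoefSpace S 0) 1
    fun c => norm_le_of_forall (by positivity) fun l g => by
      simp only [NNReal.coe_zero, add_zero, one_pow, one_mul]
      exact norm_eval_le (s := s) l g c

lemma eval_unweight (l : ℕ) (c : CoefSpace S s) : eval l (unweight S s c) = eval l c := rfl

lemma levelTrace_dualOperator_unweight (k : ℕ) :
    levelTrace k (dualOperator (unweight S s)) = 1 := by
  have h (y : S.Col k) :
      dualOperator (unweight S s) (coefDual S 0 k y) (unitVec S s k y) = 1 :=
    coefDual_unitVec (s := 0) k y
  simp only [levelTrace_apply, h, Finset.expect_const Finset.univ_nonempty]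

theorem dualOperator_unweight_notMem_approximableOperators (hS : S.IsIncoherent q) (hq : 0 ≤ q)
    (hsq : (1 + s) * q < 1)
    (hcard : Tendsto (fun k => (1 + s : ℝ) ^ k / √(Fintype.card (S.Col k))) atTop (𝓝 0)) :
    dualOperator (unweight S s) ∉ approximableOperators 𝕜 _ _ := fun hT => by
  have h := tendsto_levelTrace_of_mem_approximableOperators hS hq hsq hcard hT
  simp only [levelTrace_dualOperator_unweight] at h
  exact one_ne_zero (tendsto_nhds_unique tendsto_const_nhds h)

variable (S s) in
/-- The unweighted values of a coefficient family at the rows of the levels below `n`. -/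
def truncValues (n : ℕ) : CoefSpace S s →L[𝕜] lp (fun _ : Σ l, S.Row l => 𝕜) ∞ :=
  open Classical in
  ∑ i ∈ (Finset.range n).sigma fun _ => Finset.univ,
    (evalDual S s i.1 i.2).smulRight (lp.single ∞ i 1)

lemma truncValues_mem_finiteRankOperators (n : ℕ) :
    truncValues S s n ∈ finiteRankOperators 𝕜 _ _ :=
  Submodule.sum_mem _ fun _ _ => smulRight_mem_finiteRankOperators _ _

lemma truncValues_apply (n : ℕ) (c : CoefSpace S s) (i : Σ l, S.Row l) :
    truncValues S s n c i = if i.1 < n then eval i.1 c i.2 else 0 := by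
  rw [truncValues, FunLike.coe_sum, Finset.sum_apply, lp.coeFn_sum, Finset.sum_apply]
  simp [lp.single_apply, evalDual_apply, Pi.single_apply]

lemma norm_toBounded_comp_unweight_sub_truncValues_le (n : ℕ) :
    ‖(toBoundedₗᵢ S 0).toContinuousLinearMap.comp (unweight S s) - truncValues S s n‖ ≤
      ((1 + s : ℝ)⁻¹) ^ n := by
  refine ContinuousLinearMap.opNorm_le_bound _ (by positivity) fun c => ?_
  refine lp.norm_le_of_forall_le (by positivity) fun i => ?_
  have h_apply : ((toBoundedₗᵢ S 0).toContinuousLinearMap.comp (unweight S s) -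
      truncValues S s n) c i = eval i.1 c i.2 - if i.1 < n then eval i.1 c i.2 else 0 := by
    refine congrArg₂ (· - ·) ((toBounded_apply (unweight S s c) i).trans ?_)
      (truncValues_apply n c i)
    simp [eval_unweight]
  rw [h_apply]
  split_ifs with hi
  · rw [sub_self, norm_zero]
    positivity
  · rw [sub_zero, inv_pow, le_inv_mul_iff₀ (by positivity)]
    refine le_trans ?_ (weight_mul_norm_eval_le i.1 i.2 c)
    gcongr
    · simp
    · exact not_lt.1 hi

lemma toBounded_comp_unweight_mem_approximableOperators (hs : 0 < s) :
    (toBoundedₗᵢ S 0).toContinuousLinearMap.comp (unweight S s) ∈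
      approximableOperators 𝕜 _ _ := by
  refine mem_closure_of_tendsto (b := atTop) (f := truncValues S s) ?_
    (Eventually.of_forall truncValues_mem_finiteRankOperators)
  rw [tendsto_iff_norm_sub_tendsto_zero]
  refine squeeze_zero (fun n => norm_nonneg _) (fun n => ?_)
    (tendsto_pow_atTop_nhds_zero_of_lt_one (r := (1 + s : ℝ)⁻¹) (by positivity)
      (inv_lt_one_of_one_lt₀ (by simpa using hs)))
  rw [norm_sub_rev]
  exact norm_toBounded_comp_unweight_sub_truncValues_le n

theorem isCompactOperator_dualOperator_unweight (hs : 0 < s) :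
    IsCompactOperator (dualOperator (unweight S s)) :=
  isCompactOperator_dualOperator_of_isometry_comp_mem_approximableOperators
    (toBounded_comp_unweight_mem_approximableOperators hs)

variable (S s) in
/-- The coefficient families vanishing above level `n`. -/
def levelsUpTo (n : ℕ) : Submodule 𝕜 (CoefSpace S s) where
  carrier := {c | ∀ k, n < k → level k c = 0}
  zero_mem' _ _ := map_zero _
  add_mem' ha hb k hk := by rw [map_add, ha k hk, hb k hk, add_zero]
  smul_mem' r a ha k hk := by rw [map_smul, ha k hk, smul_zero]

lemma levelsUpTo_mono : Monotone (levelsUpTo S s) :=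
  fun _ _ h _ hc k hk => hc k (h.trans_lt hk)

lemma exists_mem_levelsUpTo (c : CoefSpace S s) : ∃ n, c ∈ levelsUpTo S s n :=
  c.exists_forall_lt_level_eq_zero

instance (n : ℕ) : FiniteDimensional 𝕜 (levelsUpTo S s n) := by
  let levels : levelsUpTo S s n →ₗ[𝕜] ∀ k : Fin (n + 1), S.Col k → 𝕜 :=
    (LinearMap.pi fun k => level k) ∘ₗ (levelsUpTo S s n).subtype
  refine Module.Finite.of_injective levels ((injective_iff_map_eq_zero levels).2 ?_)
  rintro ⟨c, hc⟩ h
  refine Subtype.ext (ext_level fun k => ?_)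
  rcases le_or_gt k n with hk | hk
  · exact congrFun h ⟨k, Nat.lt_succ_of_le hk⟩
  · exact hc k hk

instance (n : ℕ) : Nontrivial (levelsUpTo S s n) := by
  obtain ⟨y⟩ := S.nonemptyCol 0
  refine ⟨⟨unitVec S s 0 y, fun k hk => level_ofLevel_ne (by omega) _⟩, 0, fun h => ?_⟩
  have h_zero : unitVec S s 0 y = 0 := congrArg Subtype.val h
  have h_one := coefDual_unitVec (s := s) 0 y
  rw [h_zero, map_zero] at h_one
  exact zero_ne_one h_one

end CoefSpace

/-! ### Hadamard matrices with phases -/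

section SignCharacter

variable (𝕜) in
/-- The sign character `a ↦ (-1) ^ a` of `ZMod 2`. -/
def signChar : AddChar (ZMod 2) 𝕜 := AddChar.zmodChar 2 (ζ := -1) (by norm_num)

lemma signChar_apply (a : ZMod 2) : signChar 𝕜 a = (-1) ^ a.val := AddChar.zmodChar_apply _ a

lemma norm_signChar (a : ZMod 2) : ‖signChar 𝕜 a‖ = 1 := by simp [signChar_apply]

lemma conj_signChar (a : ZMod 2) : conj (signChar 𝕜 a) = signChar 𝕜 a := by simp [signChar_apply]

lemma signChar_one : signChar 𝕜 1 = -1 := by simp [signChar_apply, ZMod.val_one]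

lemma signChar_ne_one {a : ZMod 2} (ha : a ≠ 0) : signChar 𝕜 a ≠ 1 := by
  obtain rfl : a = 1 := by revert a; decide
  rw [signChar_one]
  norm_num

lemma signChar_mul_self (a : ZMod 2) : signChar 𝕜 a * signChar 𝕜 a = 1 := by
  rw [← AddChar.map_add_eq_mul, CharTwo.add_self_eq_zero, AddChar.map_zero_eq_one]

lemma signChar_add_signChar_of_ne {a b : ZMod 2} (h : a ≠ b) :
    signChar 𝕜 a + signChar 𝕜 b = 0 := by
  obtain rfl : a = b + 1 := by revert a b; decide
  rw [AddChar.map_add_eq_mul, signChar_one]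
  ring

lemma sum_signChar : ∑ t, signChar 𝕜 t = 0 :=
  (Fin.sum_univ_two _).trans (signChar_add_signChar_of_ne zero_ne_one)

lemma norm_expect_signChar_le {α : Type*} [Fintype α] {f : α → ZMod 2} {u v : α}
    (h : f u ≠ f v) : ‖𝔼 x, signChar 𝕜 (f x)‖ ≤ 1 - 2 / Fintype.card α := by
  classical
  have huv : u ≠ v := fun huv => h (congrArg f huv)
  have card_pos : (0 : ℝ) < Fintype.card α := Nat.cast_pos.2 (Fintype.card_pos_iff.2 ⟨u⟩)
  have norm_sum_le : ‖∑ x, signChar 𝕜 (f x)‖ ≤ Fintype.card α - 2 := by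
    rw [← Finset.sum_compl_add_sum {u, v}, Finset.sum_pair huv, signChar_add_signChar_of_ne h,
      add_zero]
    refine (norm_sum_le_of_le _ fun x _ => (norm_signChar (f x)).le).trans_eq ?_
    rw [Finset.sum_const, nsmul_one, Finset.card_compl, Nat.cast_sub (Finset.card_le_univ _),
      Finset.card_pair huv, Nat.cast_ofNat]
  rw [Fintype.expect_eq_sum_div_card, norm_div, RCLike.norm_natCast, div_le_iff₀ card_pos, sub_mul,
    div_mul_cancel₀ _ card_pos.ne', one_mul]
  exact norm_sum_le

lemma norm_expect_signChar_le_one {α : Type*} [Fintype α] [Nonempty α] (f : α → ZMod 2) :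
    ‖𝔼 x, signChar 𝕜 (f x)‖ ≤ 1 :=
  norm_expect_le_of_forall_le fun x => (norm_signChar (f x)).le

lemma expect_signChar_dotProduct {κ : Type*} [Fintype κ] [DecidableEq κ] (d : κ → ZMod 2) :
    𝔼 x : κ → ZMod 2, signChar 𝕜 (x ⬝ᵥ d) = if d = 0 then 1 else 0 := by
  let χ : AddChar (κ → ZMod 2) 𝕜 :=
    (signChar 𝕜).compAddMonoidHom (dotProductBilin (ZMod 2) (ZMod 2) |>.flip d).toAddMonoidHom
  have χ_apply (x : κ → ZMod 2) : χ x = signChar 𝕜 (x ⬝ᵥ d) := rfl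
  have χ_eq_zero_iff : χ = 0 ↔ d = 0 := by
    refine ⟨fun h => funext fun i => ?_, ?_⟩
    · refine by_contra fun hi : d i ≠ 0 => signChar_ne_one (𝕜 := 𝕜) hi ?_
      rw [← single_one_dotProduct i d, ← χ_apply, h, AddChar.zero_apply]
    · rintro rfl
      ext x
      rw [χ_apply, dotProduct_zero, AddChar.map_zero_eq_one, AddChar.zero_apply]
  simp only [← χ_apply, ← χ_eq_zero_iff]
  exact χ.expect_eq_ite

lemma expect_signChar_dotProduct_add {κ : Type*} [Fintype κ] [DecidableEq κ] (d d' : κ → ZMod 2) :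
    𝔼 x : κ → ZMod 2, signChar 𝕜 (x ⬝ᵥ (d + d')) = if d = d' then 1 else 0 := by
  simp only [expect_signChar_dotProduct, funext_iff, Pi.add_apply, Pi.zero_apply,
    CharTwo.add_eq_zero]

end SignCharacter

lemma expect_pi_prod {ι κ R : Type*} [Fintype ι] [DecidableEq ι] [Fintype κ] [Field R]
    [CharZero R] (f : ι → κ → R) : 𝔼 y : ι → κ, ∏ i, f i (y i) = ∏ i, 𝔼 v, f i v := by
  simp [Fintype.expect_eq_sum_div_card, Finset.prod_div_distrib, Fintype.prod_sum]

section PhaseHadamard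

variable {ι κ : Type*} [Fintype ι] [Fintype κ] {p p' : ι → (κ → ZMod 2) → ZMod 2}
  {x x' y y' : ι → κ → ZMod 2}

variable (𝕜) in
/-- The tensor product over `i : ι` of the Sylvester Hadamard matrices `(-1) ^ (x ⬝ᵥ y)`, the column
`y` of the `i`-th factor being multiplied by `(-1) ^ p i y`. -/
def phaseHadamard (p : ι → (κ → ZMod 2) → ZMod 2) : Matrix (ι → κ → ZMod 2) (ι → κ → ZMod 2) 𝕜 :=
  Matrix.of fun x y => ∏ i, signChar 𝕜 (x i ⬝ᵥ y i + p i (y i))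

lemma phaseHadamard_apply :
    phaseHadamard 𝕜 p x y = ∏ i, signChar 𝕜 (x i ⬝ᵥ y i + p i (y i)) := rfl

lemma norm_phaseHadamard : ‖phaseHadamard 𝕜 p x y‖ = 1 := by
  simp only [phaseHadamard_apply, norm_prod, norm_signChar, Finset.prod_const_one]

lemma conj_phaseHadamard : conj (phaseHadamard 𝕜 p x y) = phaseHadamard 𝕜 p x y := by
  simp only [phaseHadamard_apply, map_prod, conj_signChar]

lemma phaseHadamard_cons {n : ℕ} {p : Fin (n + 1) → (κ → ZMod 2) → ZMod 2} {b : κ → ZMod 2}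
    {x : Fin n → κ → ZMod 2} {y : Fin (n + 1) → κ → ZMod 2} :
    phaseHadamard 𝕜 p (Fin.cons b x) y =
      signChar 𝕜 (b ⬝ᵥ y 0 + p 0 (y 0)) * phaseHadamard 𝕜 (Fin.tail p) x (Fin.tail y) := by
  simp only [phaseHadamard_apply, Fin.prod_univ_succ, Fin.cons_zero, Fin.cons_succ, Fin.tail]

variable [DecidableEq ι] [DecidableEq κ]

lemma conjTranspose_phaseHadamard_mul_phaseHadamard :
    (phaseHadamard 𝕜 p)ᴴ * phaseHadamard 𝕜 p' =
      (Fintype.card (ι → κ → ZMod 2) : 𝕜) •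
        Matrix.diagonal fun y => ∏ i, signChar 𝕜 (p i (y i) + p' i (y i)) := by
  ext y y'
  have entry (x : ι → κ → ZMod 2) :
      conj (phaseHadamard 𝕜 p x y) * phaseHadamard 𝕜 p' x y' =
        ∏ i, signChar 𝕜 (p i (y i) + p' i (y' i)) * signChar 𝕜 (x i ⬝ᵥ (y i + y' i)) := by
    rw [conj_phaseHadamard, phaseHadamard_apply, phaseHadamard_apply, ← Finset.prod_mul_distrib]
    refine Finset.prod_congr rfl fun i _ => ?_
    rw [← AddChar.map_add_eq_mul, ← AddChar.map_add_eq_mul, dotProduct_add]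
    congr 1
    ring
  simp only [Matrix.mul_apply, Matrix.conjTranspose_apply, RCLike.star_def, entry,
    Matrix.smul_apply, smul_eq_mul, Matrix.diagonal_apply]
  rw [← Fintype.card_mul_expect, expect_pi_prod fun i u =>
    signChar 𝕜 (p i (y i) + p' i (y' i)) * signChar 𝕜 (u ⬝ᵥ (y i + y' i))]
  simp only [← Finset.mul_expect, expect_signChar_dotProduct_add]
  split_ifs with hy
  · simp only [hy, if_true, mul_one]
  · obtain ⟨i, hi⟩ := Function.ne_iff.1 hy
    rw [Finset.prod_eq_zero (Finset.mem_univ i) (by rw [if_neg hi, mul_zero])]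

lemma conjTranspose_phaseHadamard_mul_self :
    (phaseHadamard 𝕜 p)ᴴ * phaseHadamard 𝕜 p = (Fintype.card (ι → κ → ZMod 2) : 𝕜) • 1 := by
  simp only [conjTranspose_phaseHadamard_mul_phaseHadamard, CharTwo.add_self_eq_zero,
    AddChar.map_zero_eq_one, Finset.prod_const_one, Matrix.diagonal_one]

lemma expect_phaseHadamard_mul_conj_phaseHadamard :
    𝔼 y, phaseHadamard 𝕜 p x y * conj (phaseHadamard 𝕜 p' x' y) =
      ∏ i, 𝔼 v, signChar 𝕜 (v ⬝ᵥ (x i + x' i) + (p i v + p' i v)) := by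
  rw [← expect_pi_prod]
  refine Finset.expect_congr rfl fun y _ => ?_
  rw [conj_phaseHadamard, phaseHadamard_apply, phaseHadamard_apply, ← Finset.prod_mul_distrib]
  refine Finset.prod_congr rfl fun i _ => ?_
  rw [← AddChar.map_add_eq_mul, dotProduct_comm, dotProduct_comm (x' i), dotProduct_add]
  congr 1
  ring

lemma expect_phaseHadamard_mul_conj_phaseHadamard_of_ne (hx : x ≠ x') :
    𝔼 y, phaseHadamard 𝕜 p x y * conj (phaseHadamard 𝕜 p x' y) = 0 := by
  obtain ⟨i, hi⟩ := Function.ne_iff.1 hx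
  rw [expect_phaseHadamard_mul_conj_phaseHadamard]
  refine Finset.prod_eq_zero (Finset.mem_univ i) ?_
  simp only [CharTwo.add_self_eq_zero, add_zero, expect_signChar_dotProduct_add, if_neg hi]

end PhaseHadamard

section QuadraticPhase

/-- The quadratic form `t v₀ v₁` on `ZMod 2 ^ 4`, to which `some b` adds the form
`v₂ v₃ + b₀ v₀ v₂ + b₁ v₀ v₃ + b₂ v₁ v₂ + b₃ v₁ v₃`. No two of these forms differ by a linear form,
which makes the rows of `phaseHadamard` for different parameters incoherent. -/
def quadraticPhase (t : ZMod 2) (o : Option (Fin 4 → ZMod 2)) (v : Fin 4 → ZMod 2) : ZMod 2 :=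
  t * v 0 * v 1 + o.elim 0 fun b =>
    v 2 * v 3 + b 0 * v 0 * v 2 + b 1 * v 0 * v 3 + b 2 * v 1 * v 2 + b 3 * v 1 * v 3

variable {t t' : ZMod 2} {o o' : Option (Fin 4 → ZMod 2)}

lemma quadraticPhase_zero_none : quadraticPhase 0 none = 0 := by
  ext v
  simp [quadraticPhase]

lemma quadraticPhase_add_eq_of_fst_eq (v : Fin 4 → ZMod 2) :
    quadraticPhase t o v + quadraticPhase t o' v =
      quadraticPhase 0 o v + quadraticPhase 0 o' v := by
  simp only [quadraticPhase, zero_mul, zero_add]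
  rw [add_add_add_comm, CharTwo.add_self_eq_zero, zero_add]

lemma quadraticPhase_single (i : Fin 4) : quadraticPhase t o (Pi.single i 1) = 0 := by
  rcases o with _ | b <;> fin_cases i <;> simp [quadraticPhase]

lemma quadraticPhase_injective2 : Function.Injective2 quadraticPhase := by
  intro t t' o o' h
  have ht : t = t' := by
    have := congrFun h ![1, 1, 0, 0]
    rcases o with _ | b <;> rcases o' with _ | b' <;> simpa [quadraticPhase] using this
  refine ⟨ht, ?_⟩
  rcases o with _ | b <;> rcases o' with _ | b'
  · rfl
  · exact absurd (congrFun h ![0, 0, 1, 1]) (by simp [quadraticPhase])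
  · exact absurd (congrFun h ![0, 0, 1, 1]) (by simp [quadraticPhase])
  · refine congrArg some (funext fun i => ?_)
    fin_cases i
    · simpa [quadraticPhase] using congrFun h ![1, 0, 1, 0]
    · simpa [quadraticPhase] using congrFun h ![1, 0, 0, 1]
    · simpa [quadraticPhase] using congrFun h ![0, 1, 1, 0]
    · simpa [quadraticPhase] using congrFun h ![0, 1, 0, 1]

lemma quadraticPhase_zero : quadraticPhase t o 0 = 0 := by
  rcases o with _ | b <;> simp [quadraticPhase]

lemma norm_expect_signChar_quadraticPhase_le (h : (t, o) ≠ (t', o')) (x : Fin 4 → ZMod 2) :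
    ‖𝔼 v, signChar 𝕜 (v ⬝ᵥ x + (quadraticPhase t o v + quadraticPhase t' o' v))‖ ≤ 7 / 8 := by
  let f v := v ⬝ᵥ x + (quadraticPhase t o v + quadraticPhase t' o' v)
  have f_zero : f 0 = 0 := by
    simp only [f, zero_dotProduct, quadraticPhase_zero, add_zero]
  obtain ⟨v, hv⟩ : ∃ v, f v ≠ 0 := by
    by_contra! hf
    have x_eq_zero (i : Fin 4) : x i = 0 := by
      simpa only [f, single_one_dotProduct, quadraticPhase_single, add_zero]
        using hf (Pi.single i 1)
    obtain rfl : x = 0 := funext x_eq_zero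
    refine h (Prod.ext_iff.2 (quadraticPhase_injective2 (funext fun v => ?_)))
    simpa only [f, dotProduct_zero, zero_add, CharTwo.add_eq_zero] using hf v
  refine (norm_expect_signChar_le (f := f) (hv.trans_eq f_zero.symm)).trans_eq ?_
  norm_num [ZMod.card]

lemma norm_expect_phaseHadamard_quadraticPhase_le {ι : Type*} [Fintype ι] [DecidableEq ι]
    {t t' : ι → ZMod 2} {o o' : ι → Option (Fin 4 → ZMod 2)} {A : Finset ι}
    (h : ∀ i ∈ A, (t i, o i) ≠ (t' i, o' i)) (x x' : ι → Fin 4 → ZMod 2) :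
    ‖𝔼 y, phaseHadamard 𝕜 (fun i => quadraticPhase (t i) (o i)) x y *
      conj (phaseHadamard 𝕜 (fun i => quadraticPhase (t' i) (o' i)) x' y)‖ ≤ (7 / 8) ^ A.card := by
  rw [expect_phaseHadamard_mul_conj_phaseHadamard, norm_prod]
  calc
    _ ≤ ∏ i, if i ∈ A then (7 / 8 : ℝ) else 1 := by
      refine Finset.prod_le_prod (fun i _ => norm_nonneg _) fun i _ => ?_
      split_ifs with hi
      · exact norm_expect_signChar_quadraticPhase_le (h i hi) _
      · exact norm_expect_signChar_le_one _
    _ = (7 / 8) ^ A.card := by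
      rw [Finset.prod_ite_mem, Finset.univ_inter, Finset.prod_const]

end QuadraticPhase

section HadamardSystem

variable (𝕜) in
/-- The lower matrices of `hadamardSystem`: row `(z, t)` is the row `Fin.tail z` of a Hadamard
matrix with a phase determined by `z 0` and `t`, multiplied by `(-1) ^ t`. -/
def hadamardLower (k : ℕ) :
    Matrix ((Fin (k + 1) → Fin 4 → ZMod 2) × ZMod 2) (Fin k → Fin 4 → ZMod 2) 𝕜 :=
  Matrix.of fun g y => signChar 𝕜 g.2 *
    phaseHadamard 𝕜 (fun _ => quadraticPhase g.2 (some (g.1 0))) (Fin.tail g.1) y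

variable (𝕜) in
/-- The upper matrices of `hadamardSystem`: row `(z, t)` is the row `z` of a Hadamard matrix with a
phase determined by `t`. -/
def hadamardUpper (k : ℕ) :
    Matrix ((Fin (k + 1) → Fin 4 → ZMod 2) × ZMod 2) (Fin (k + 1) → Fin 4 → ZMod 2) 𝕜 :=
  Matrix.of fun g y => phaseHadamard 𝕜
    (fun i => quadraticPhase (Fin.cons (α := fun _ => ZMod 2) 0 (fun _ => g.2) i) none) g.1 y

variable {k : ℕ}

lemma hadamardLower_cons (b : Fin 4 → ZMod 2) (x y : Fin k → Fin 4 → ZMod 2) (t : ZMod 2) :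
    hadamardLower 𝕜 k (Fin.cons b x, t) y =
      signChar 𝕜 t * phaseHadamard 𝕜 (fun _ => quadraticPhase t (some b)) x y := rfl

lemma hadamardUpper_cons (b : Fin 4 → ZMod 2) (x : Fin k → Fin 4 → ZMod 2) (t : ZMod 2)
    (y : Fin (k + 1) → Fin 4 → ZMod 2) :
    hadamardUpper 𝕜 k (Fin.cons b x, t) y = signChar 𝕜 (b ⬝ᵥ y 0) *
      phaseHadamard 𝕜 (fun _ => quadraticPhase t none) x (Fin.tail y) := by
  refine phaseHadamard_cons.trans ?_
  rw [Fin.cons_zero, quadraticPhase_zero_none, Pi.zero_apply, add_zero]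
  rfl

lemma sum_prod_fin_succ_pi {κ β M : Type*} [Fintype κ] [Fintype β] [AddCommMonoid M]
    (f : (Fin (k + 1) → κ) × β → M) :
    ∑ g, f g = ∑ t, ∑ b, ∑ x, f (Fin.cons b x, t) := by
  rw [Fintype.sum_prod_type_right]
  refine Finset.sum_congr rfl fun t _ => ?_
  rw [← (Fin.consEquiv fun _ => κ).sum_comp, Fintype.sum_prod_type]
  rfl

lemma conjTranspose_hadamardUpper_mul_hadamardUpper :
    (hadamardUpper 𝕜 k)ᴴ * hadamardUpper 𝕜 k =
      (Fintype.card ((Fin (k + 1) → Fin 4 → ZMod 2) × ZMod 2) : 𝕜) • 1 := by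
  ext y y'
  have sum_fst (t : ZMod 2) :
      ∑ z, star (hadamardUpper 𝕜 k (z, t) y) * hadamardUpper 𝕜 k (z, t) y' =
        (Fintype.card (Fin (k + 1) → Fin 4 → ZMod 2) : 𝕜) * (1 : Matrix _ _ 𝕜) y y' :=
    congrFun₂ (conjTranspose_phaseHadamard_mul_self (𝕜 := 𝕜) (p := fun i : Fin (k + 1) =>
      quadraticPhase (Fin.cons (α := fun _ => ZMod 2) 0 (fun _ => t) i) none)) y y'
  simp only [Matrix.mul_apply, Fintype.sum_prod_type_right, Matrix.conjTranspose_apply, sum_fst,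
    Finset.sum_const, Finset.card_univ, Fintype.card_prod, Matrix.smul_apply, nsmul_eq_mul,
    Nat.cast_mul, smul_eq_mul]
  ring

lemma conjTranspose_hadamardLower_mul_hadamardLower :
    (hadamardLower 𝕜 k)ᴴ * hadamardLower 𝕜 k =
      (Fintype.card ((Fin (k + 1) → Fin 4 → ZMod 2) × ZMod 2) : 𝕜) • 1 := by
  ext y y'
  have sum_tail (b : Fin 4 → ZMod 2) (t : ZMod 2) :
      ∑ x, star (hadamardLower 𝕜 k (Fin.cons b x, t) y) * hadamardLower 𝕜 k (Fin.cons b x, t) y' =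
        (Fintype.card (Fin k → Fin 4 → ZMod 2) : 𝕜) * (1 : Matrix _ _ 𝕜) y y' := by
    refine Eq.trans (Finset.sum_congr rfl fun x _ => ?_)
      (congrFun₂ (conjTranspose_phaseHadamard_mul_self (p := fun _ => quadraticPhase t (some b)))
        y y')
    rw [hadamardLower_cons, hadamardLower_cons, StarMul.star_mul, RCLike.star_def, conj_signChar,
      mul_comm (conj _), mul_mul_mul_comm, signChar_mul_self, one_mul]
    rfl
  simp only [Matrix.mul_apply, sum_prod_fin_succ_pi, Matrix.conjTranspose_apply, sum_tail,
    Finset.sum_const, Finset.card_univ, Fintype.card_prod, Matrix.smul_apply, nsmul_eq_mul,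
    Nat.cast_mul, smul_eq_mul, Fintype.card_pi_const, Nat.cast_pow]
  ring

lemma conjTranspose_hadamardLower_mul_hadamardUpper :
    (hadamardLower 𝕜 k)ᴴ * hadamardUpper 𝕜 k = 0 := by
  ext y y'
  have sum_tail (b : Fin 4 → ZMod 2) : ∃ c : 𝕜, ∀ t,
      ∑ x, star (hadamardLower 𝕜 k (Fin.cons b x, t) y) * hadamardUpper 𝕜 k (Fin.cons b x, t) y' =
        signChar 𝕜 t * c := by
    let D : Matrix (Fin k → Fin 4 → ZMod 2) (Fin k → Fin 4 → ZMod 2) 𝕜 := Matrix.diagonal fun y =>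
      ∏ i, signChar 𝕜 (quadraticPhase 0 (some b) (y i) + quadraticPhase 0 none (y i))
    have phase_mul (t : ZMod 2) :
        (phaseHadamard 𝕜 fun _ : Fin k => quadraticPhase t (some b))ᴴ *
            phaseHadamard 𝕜 (fun _ => quadraticPhase t none) =
          (Fintype.card (Fin k → Fin 4 → ZMod 2) : 𝕜) • D := by
      simp only [conjTranspose_phaseHadamard_mul_phaseHadamard,
        quadraticPhase_add_eq_of_fst_eq (t := t), D]
    refine ⟨signChar 𝕜 (b ⬝ᵥ y' 0) *
      ((Fintype.card (Fin k → Fin 4 → ZMod 2) : 𝕜) • D) y (Fin.tail y'), fun t => ?_⟩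
    rw [← phase_mul t, Matrix.mul_apply, ← mul_assoc, Finset.mul_sum]
    refine Finset.sum_congr rfl fun x _ => ?_
    rw [hadamardLower_cons, hadamardUpper_cons, StarMul.star_mul, RCLike.star_def, conj_signChar,
      mul_comm (conj _), mul_mul_mul_comm]
    rfl
  choose c hc using sum_tail
  simp only [Matrix.mul_apply, sum_prod_fin_succ_pi, Matrix.conjTranspose_apply, hc,
    ← Finset.mul_sum, ← Finset.sum_mul, sum_signChar, zero_mul, Matrix.zero_apply]

variable (𝕜) in
/-- A unimodular system of signed Hadamard matrices, with `16 ^ k` columns at level `k`. -/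
def hadamardSystem : UnimodularSystem 𝕜 where
  Col k := Fin k → Fin 4 → ZMod 2
  Row k := (Fin (k + 1) → Fin 4 → ZMod 2) × ZMod 2
  lower := hadamardLower 𝕜
  upper := hadamardUpper 𝕜
  norm_lower _ _ _ := by
    rw [hadamardLower, Matrix.of_apply, norm_mul, norm_signChar, norm_phaseHadamard, one_mul]
  norm_upper _ _ _ := by rw [hadamardUpper, Matrix.of_apply, norm_phaseHadamard]
  conjTranspose_lower_mul_lower _ := conjTranspose_hadamardLower_mul_hadamardLower
  conjTranspose_upper_mul_upper _ := conjTranspose_hadamardUpper_mul_hadamardUpper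
  conjTranspose_lower_mul_upper _ := conjTranspose_hadamardLower_mul_hadamardUpper

lemma norm_expect_hadamardLower_mul_conj_le {g h : (Fin (k + 1) → Fin 4 → ZMod 2) × ZMod 2}
    (hgh : g ≠ h) :
    ‖𝔼 y, hadamardLower 𝕜 k g y * conj (hadamardLower 𝕜 k h y)‖ ≤ (7 / 8) ^ k := by
  simp only [hadamardLower, Matrix.of_apply, map_mul, mul_mul_mul_comm, ← Finset.mul_expect,
    norm_mul, RCLike.norm_conj, norm_signChar, one_mul]
  by_cases hphase : (g.2, some (g.1 0)) = (h.2, some (h.1 0))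
  · obtain ⟨h_snd, h_zero⟩ : g.2 = h.2 ∧ g.1 0 = h.1 0 := by
      simpa only [Prod.mk.injEq, Option.some.injEq] using hphase
    have tail_ne : Fin.tail g.1 ≠ Fin.tail h.1 := fun h_tail => hgh <| Prod.ext
      (by rw [← Fin.cons_self_tail g.1, h_zero, h_tail, Fin.cons_self_tail]) h_snd
    rw [h_snd, h_zero, expect_phaseHadamard_mul_conj_phaseHadamard_of_ne tail_ne, norm_zero]
    positivity
  · refine (norm_expect_phaseHadamard_quadraticPhase_le (A := Finset.univ)
      (fun _ _ => hphase) _ _).trans_eq ?_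
    rw [Finset.card_univ, Fintype.card_fin]

lemma norm_expect_hadamardUpper_mul_conj_le {g h : (Fin (k + 1) → Fin 4 → ZMod 2) × ZMod 2}
    (hgh : g ≠ h) :
    ‖𝔼 y, hadamardUpper 𝕜 k g y * conj (hadamardUpper 𝕜 k h y)‖ ≤ (7 / 8) ^ k := by
  simp only [hadamardUpper, Matrix.of_apply]
  by_cases h_snd : g.2 = h.2
  · have fst_ne : g.1 ≠ h.1 := fun h_fst => hgh (Prod.ext h_fst h_snd)
    rw [h_snd, expect_phaseHadamard_mul_conj_phaseHadamard_of_ne fst_ne, norm_zero]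
    positivity
  · refine (norm_expect_phaseHadamard_quadraticPhase_le (A := Finset.univ.map (Fin.succEmb k))
      ?_ _ _).trans_eq ?_
    · intro i hi h_pair
      obtain ⟨j, -, rfl⟩ := Finset.mem_map.1 hi
      exact h_snd (congrArg Prod.fst h_pair)
    · rw [Finset.card_map, Finset.card_univ, Fintype.card_fin]

lemma norm_expect_hadamardLower_mul_conj_hadamardUpper_le
    (g : (Fin (k + 2) → Fin 4 → ZMod 2) × ZMod 2) (h : (Fin (k + 1) → Fin 4 → ZMod 2) × ZMod 2) :
    ‖𝔼 y, hadamardLower 𝕜 (k + 1) g y * conj (hadamardUpper 𝕜 k h y)‖ ≤ (7 / 8) ^ (k + 1) := by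
  simp only [hadamardLower, hadamardUpper, Matrix.of_apply, mul_assoc, ← Finset.mul_expect,
    norm_mul, norm_signChar, one_mul]
  refine (norm_expect_phaseHadamard_quadraticPhase_le (A := Finset.univ) ?_ _ _).trans_eq ?_
  · exact fun i _ h => Option.some_ne_none _ (congrArg Prod.snd h)
  · rw [Finset.card_univ, Fintype.card_fin]

lemma isIncoherent_hadamardSystem : (hadamardSystem 𝕜).IsIncoherent (7 / 8) where
  norm_expect_lower_le _ _ _ := norm_expect_hadamardLower_mul_conj_le
  norm_expect_upper_le _ _ _ := norm_expect_hadamardUpper_mul_conj_le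
  norm_expect_lower_upper_le _ := norm_expect_hadamardLower_mul_conj_hadamardUpper_le

lemma tendsto_pow_div_sqrt_card_hadamardSystem {s : ℝ} (hs : 0 ≤ s) (hs' : s < 3) :
    Tendsto (fun k => (1 + s) ^ k / √(Fintype.card ((hadamardSystem 𝕜).Col k))) atTop (𝓝 0) := by
  have sqrt_card (k : ℕ) : √(Fintype.card ((hadamardSystem 𝕜).Col k)) = 4 ^ k := by
    have card_eq : Fintype.card ((hadamardSystem 𝕜).Col k) = (4 ^ k) ^ 2 := by
      refine (Fintype.card_pi_const _ k).trans ?_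
      rw [Fintype.card_pi_const, ZMod.card, pow_right_comm 4]
      norm_num
    rw [card_eq, Nat.cast_pow, Real.sqrt_sq (by positivity)]
    norm_num
  simp only [sqrt_card, ← div_pow]
  exact tendsto_pow_atTop_nhds_zero_of_lt_one (by positivity) (by linarith)

end HadamardSystem

end

theorem mainTheorem6 {𝕜 : Type*} [RCLike 𝕜] (E : ℕ → Type*)
    [∀ n, NormedAddCommGroup (E n)] [∀ n, NormedSpace 𝕜 (E n)]
    [∀ n, FiniteDimensional 𝕜 (E n)]
    (hE : BanachMazurDense 𝕜 E)
    (σ : ℕ → ℕ) (hσ : ∀ n, {m | σ m = n}.Infinite) :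
    ContainsCopyOfC0 𝕜 (CompactByApproximable 𝕜 (StrongDual 𝕜 (JohnsonC1 E σ))) ∧
      Subsingleton (CompactByApproximable 𝕜 (JohnsonC1 E σ)) := by
  constructor
  · let S := hadamardSystem 𝕜
    let s : NNReal := 1 / 8
    have h_compact : IsCompactOperator (dualOperator (CoefSpace.unweight S s)) :=
      CoefSpace.isCompactOperator_dualOperator_unweight (by norm_num [s])
    have h_notMem : dualOperator (CoefSpace.unweight S s) ∉ approximableOperators 𝕜 _ _ :=
      CoefSpace.dualOperator_unweight_notMem_approximableOperators isIncoherent_hadamardSystem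
        (by norm_num) (by norm_num [s])
        (tendsto_pow_div_sqrt_card_hadamardSystem (by positivity) (by norm_num [s]))
    obtain ⟨B₀, R₀, -, -, hRB₀⟩ := exists_disjoint_complemented_duals hE hσ
      CoefSpace.levelsUpTo_mono (CoefSpace.exists_mem_levelsUpTo (S := S) (s := 0))
    obtain ⟨B, R, hB, hR, hRB⟩ := exists_disjoint_complemented_duals hE hσ
      CoefSpace.levelsUpTo_mono (CoefSpace.exists_mem_levelsUpTo (S := S) (s := s))
    have h_retract (ψ) : R₀ 0 (B₀ 1 ψ) = ψ := (hRB₀ 0 1 ψ).trans (one_smul 𝕜 ψ)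
    exact containsCopyOfC0_compactByApproximable h_compact h_notMem h_retract
      (fun a => (hB a).trans_eq (one_mul _).symm) hR hRB
  · refine Submodule.Quotient.subsingleton_iff.2 (eq_top_iff.2 fun T _ => ?_)
    exact mem_approximableOperators_lp_one_of_isCompactOperator T.2
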